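/- **Setup.** Let $a,b$ be coprime positive integers, $X=\{(x,y)\in(\mathbb C^*)^2:\ x^ay^b=1\}$ and $W=x+y:X\to\mathbb C$. The critical values of $W$ are $\lambda_j=\lambda_0\zeta^{-j}$ ($0\le j<a+b$), where $\zeta=e^{2\pi i/(a+b)}$ and $\lambda_0$ is the positive real root of $\lambda^{a+b}=(a+b)^{a+b}/(a^ab^b)$. Let $\gamma_j$ be the straight segment from $0$ to $\lambda_j$, $\Sigma_0=W^{-1}(0)$ (a finite set), $D_j\subset X$ the Lefschetz thimble over $\gamma_j$ (the union of the lifts of $\gamma_j$ to $X$ that end at a critical point of $W$), and $L_j=D_j\cap\Sigma_0$ its boundary, the vanishing cycle. Let $\Omega$ be the $1$-form on $X$ with $\Omega\wedge d(x^ay^b)=d\log x\wedge d\log y$. A grading of $L_j$ is a function $\tilde\phi_j:L_j\to\mathbb R$ obtained by restricting to $L_j=\partial D_j$ a continuous real lift of the phase $\arg\Omega|_{D_j}$ and subtracting a real number that is an argument of $\lambda_j$. The degree of $p\in L_i\cap L_j$, $i<j$, is $\frac1\pi(\tilde\phi_j(p)-\tilde\phi_i(p))$. Let $k$ be a field. The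 directed $A_\infty$-category $\mathrm{Lag}_{vc}(W,\{\gamma_j\})$ over $k$ has objects $L_0,\dots,L_{a+b-1}$; $\mathrm{Hom}(L_i,L_j)$ is the graded $k$-vector space with basis $L_i\cap L_j$ if $i<j$, is $k\cdot\mathrm{id}$ if $i=j$, and is $0$ if $i>j$. For $i_0<\dots<i_n$ the operation $m_n$, of degree $2-n$, counts, modulo automorphisms of the disc, holomorphic maps $u$ from the closed unit disc with $n+1$ cyclically ordered boundary marked points to $\Sigma_0$, sending the boundary arcs to $L_{i_0},\dots,L_{i_n}$ and the marked points to the given intersection points. Each is counted with a sign $\pm1$ and a weight $\tau\bigl(\int u^*\omega\bigr)$, where $\omega$ is a symplectic form on $X$ and $\tau:(\mathbb R,+)\to k^*$ is a homomorphism (for $k=\mathbb C$ one takes $\tau(A)=e^{-A}$). All other operations vanish, except that $m_2(\mathrm{id},\cdot)$ and $m_2(\cdot,\mathrm{id})$ are the identity. For $\theta\in\mathrm M(2,k^*)$, a $2\times2$ matrix with entries in $k^*$, let $\Lambda_\theta$ be the bigraded algebra generated by $y_0\in\Lambda^1_{-a}$ and $y_1\in\Lambda^1_{-b}$ with relations $\theta_{ij}y_iy_j+\theta_{ji}y_jy_i=0$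 and $y_i^2=0$. Let $\mathfrak C_\theta$ be the DG category with objects $w_0,\dots,w_{a+b-1}$, $\mathrm{Hom}^\bullet(w_j,w_i)=(\Lambda_\theta^\bullet)_{i-j}$, zero differential, and composition given by the product of $\Lambda_\theta$. **Theorem.** There is a choice of gradings of the vanishing cycles $L_0,\dots,L_{a+b-1}$ such that the following hold. 1. There are $a+b$ distinct points $x_i\in L_i\cap L_{i+a}$ $(0\le i<b)$ and $y_i\in L_i\cap L_{i+b}$ $(0\le i<a)$, they are all the intersection points of pairs $L_i,L_j$ with $i<j$ (and each of them lies in $L_i\cap L_j$, $i<j$, only for the pair indicated), and all of them have degree $1$. 2. For every symplectic form, every weight $\tau$ and every choice of signs, $\mathrm{Lag}_{vc}(W,\{\gamma_j\})$ is a DG category (that is, $m_n=0$ unless $n\in\{1,2\}$, and $m_1,m_2$ satisfy the axioms of a DG category), and for every $\theta\in\mathrm M(2,k^*)$ there is an equivalence of DG categories $\mathrm{Lag}_{vc}(W,\{\gamma_j\})\to\mathfrak C_\theta$ which takes $L_j$ to $w_{a+b-1-j}$ for all $j$. -/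

import Mathlib

noncomputable section

/-! ### DG categories and families of `A∞`-operations -/

/-- A (small) DG category over `k`. The graded space of morphisms is given by its homogeneous
pieces `Hom X Y n`. Composition is written in diagrammatic order, `comp f g` is "first `f`, then
`g`", and is a morphism of complexes `Hom X Y ⊗ Hom Y Z ⟶ Hom X Z`. Degrees are tracked by
equations (`p + 1 = q`, `p + q = r`) in order to avoid casts. -/
structure DGCat (k : Type*) [Field k] where
  Obj : Type
  Hom : Obj → Obj → ℤ → Type*
  [instAddCommGroup : ∀ X Y n, AddCommGroup (Hom X Y n)]
  [instModule : ∀ X Y n, Module k (Hom X Y n)]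
  /-- the differential, of degree `1` -/
  d : ∀ {X Y : Obj} (p q : ℤ), p + 1 = q → (Hom X Y p →ₗ[k] Hom X Y q)
  comp : ∀ {X Y Z : Obj} (p q r : ℤ), p + q = r → (Hom X Y p →ₗ[k] Hom Y Z q →ₗ[k] Hom X Z r)
  one : ∀ X : Obj, Hom X X 0
  d_d : ∀ {X Y : Obj} (p q r : ℤ) (h : p + 1 = q) (h' : q + 1 = r) (f : Hom X Y p),
    d q r h' (d p q h f) = 0
  leibniz : ∀ {X Y Z : Obj} (p q r : ℤ) (h : p + q = r) (f : Hom X Y p) (g : Hom Y Z q),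
    d r (r + 1) rfl (comp p q r h f g) =
      comp (p + 1) q (r + 1) (by omega) (d p (p + 1) rfl f) g +
        (p.negOnePow : ℤ) • comp p (q + 1) (r + 1) (by omega) f (d q (q + 1) rfl g)
  one_comp : ∀ {X Y : Obj} (p : ℤ) (f : Hom X Y p), comp 0 p p (by omega) (one X) f = f
  comp_one : ∀ {X Y : Obj} (p : ℤ) (f : Hom X Y p), comp p 0 p (by omega) f (one Y) = f
  assoc : ∀ {X Y Z T : Obj} (p q r pq qr s : ℤ) (h₁ : p + q = pq) (h₂ : q + r = qr)
    (h₃ : pq + r = s) (h₄ : p + qr = s) (f : Hom X Y p) (g : Hom Y Z q) (h : Hom Z T r),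
    comp pq r s h₃ (comp p q pq h₁ f g) h = comp p qr s h₄ f (comp q r qr h₂ g h)

attribute [instance] DGCat.instAddCommGroup DGCat.instModule

/-- A DG functor: linear, of degree zero, compatible with differentials, compositions, units. -/
structure DGFunctor {k : Type*} [Field k] (C D : DGCat k) where
  obj : C.Obj → D.Obj
  map : ∀ {X Y : C.Obj} (n : ℤ), C.Hom X Y n →ₗ[k] D.Hom (obj X) (obj Y) n
  map_d : ∀ {X Y : C.Obj} (p q : ℤ) (h : p + 1 = q) (f : C.Hom X Y p),
    map q (C.d p q h f) = D.d p q h (map p f)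
  map_comp : ∀ {X Y Z : C.Obj} (p q r : ℤ) (h : p + q = r) (f : C.Hom X Y p) (g : C.Hom Y Z q),
    map r (C.comp p q r h f g) = D.comp p q r h (map p f) (map q g)
  map_one : ∀ X : C.Obj, map 0 (C.one X) = D.one (obj X)

/-- A DG functor is an equivalence if it is bijective on all morphism complexes and if every
object of the target is isomorphic, through closed morphisms of degree `0`, to one in the image. -/
def DGFunctor.IsEquivalence {k : Type*} [Field k] {C D : DGCat k} (F : DGFunctor C D) : Prop :=
  (∀ (X Y : C.Obj) (n : ℤ), Function.Bijective (F.map (X := X) (Y := Y) n)) ∧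
  ∀ Z : D.Obj, ∃ (X : C.Obj) (f : D.Hom (F.obj X) Z 0) (g : D.Hom Z (F.obj X) 0),
    D.d 0 1 (by omega) f = 0 ∧ D.d 0 1 (by omega) g = 0 ∧
    D.comp 0 0 0 (by omega) f g = D.one (F.obj X) ∧ D.comp 0 0 0 (by omega) g f = D.one Z

/-- The data of an `A∞`-category with units: graded morphism spaces and multilinear operations
`m n : Hom(X₀, X₁) ⊗ ⋯ ⊗ Hom(Xₙ₋₁, Xₙ) ⟶ Hom(X₀, Xₙ)` of degree `2 - n`. The tuple `e` lists the
degrees of the arguments, and `r` is the degree of the result. -/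
structure AInfOps (k : Type*) [Field k] where
  Obj : Type
  Hom : Obj → Obj → ℤ → Type*
  [instAddCommGroup : ∀ X Y n, AddCommGroup (Hom X Y n)]
  [instModule : ∀ X Y n, Module k (Hom X Y n)]
  one : ∀ X : Obj, Hom X X 0
  m : ∀ (n : ℕ) (I : Fin (n + 1) → Obj) (e : Fin n → ℤ) (r : ℤ), ∑ s, e s + 2 = r + n →
    MultilinearMap k (fun s : Fin n => Hom (I s.castSucc) (I s.succ) (e s))
      (Hom (I 0) (I (Fin.last n)) r)

attribute [instance] AInfOps.instAddCommGroup AInfOps.instModule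

namespace AInfOps

variable {k : Type*} [Field k] (A : AInfOps k)

/-- The operation `m₁`. -/
def d {X Y : A.Obj} (p q : ℤ) (h : p + 1 = q) : A.Hom X Y p →ₗ[k] A.Hom X Y q where
  toFun f := A.m 1 ![X, Y] ![p] q (by simp; omega) (Fin.cons f finZeroElim)
  map_add' f g := (A.m 1 ![X, Y] ![p] q (by simp; omega)).cons_add finZeroElim f g
  map_smul' c f := (A.m 1 ![X, Y] ![p] q (by simp; omega)).cons_smul finZeroElim c f

/-- The operation `m₂`. -/
def comp {X Y Z : A.Obj} (p q r : ℤ) (h : p + q = r) :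
    A.Hom X Y p →ₗ[k] A.Hom Y Z q →ₗ[k] A.Hom X Z r :=
  let μ := A.m 2 ![X, Y, Z] ![p, q] r (by simp; omega)
  LinearMap.mk₂ k (fun (f : A.Hom X Y p) (g : A.Hom Y Z q) =>
      μ (Fin.cons f (Fin.cons g finZeroElim)))
    (fun f f' g => μ.cons_add (Fin.cons g finZeroElim) f f')
    (fun c f g => μ.cons_smul (Fin.cons g finZeroElim) c f)
    (fun f g g' => (μ.curryLeft f).cons_add finZeroElim g g')
    (fun c f g => (μ.curryLeft f).cons_smul finZeroElim c g)

/-- The operations define a DG category: all of them except `m₁` and `m₂` vanish, and `m₁`, `m₂`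
and the units satisfy the axioms of a DG category (these are then the `A∞`-relations). -/
structure IsDG : Prop where
  m_eq_zero : ∀ (n : ℕ), n ≠ 1 → n ≠ 2 → ∀ (I : Fin (n + 1) → A.Obj) (e : Fin n → ℤ) (r : ℤ)
    (h : ∑ s, e s + 2 = r + n), A.m n I e r h = 0
  d_d : ∀ {X Y : A.Obj} (p q r : ℤ) (h : p + 1 = q) (h' : q + 1 = r) (f : A.Hom X Y p),
    A.d q r h' (A.d p q h f) = 0
  leibniz : ∀ {X Y Z : A.Obj} (p q r : ℤ) (h : p + q = r) (f : A.Hom X Y p) (g : A.Hom Y Z q),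
    A.d r (r + 1) rfl (A.comp p q r h f g) =
      A.comp (p + 1) q (r + 1) (by omega) (A.d p (p + 1) rfl f) g +
        (p.negOnePow : ℤ) • A.comp p (q + 1) (r + 1) (by omega) f (A.d q (q + 1) rfl g)
  one_comp : ∀ {X Y : A.Obj} (p : ℤ) (f : A.Hom X Y p),
    A.comp 0 p p (by omega) (A.one X) f = f
  comp_one : ∀ {X Y : A.Obj} (p : ℤ) (f : A.Hom X Y p),
    A.comp p 0 p (by omega) f (A.one Y) = f
  assoc : ∀ {X Y Z T : A.Obj} (p q r pq qr s : ℤ) (h₁ : p + q = pq) (h₂ : q + r = qr)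
    (h₃ : pq + r = s) (h₄ : p + qr = s) (f : A.Hom X Y p) (g : A.Hom Y Z q) (h : A.Hom Z T r),
    A.comp pq r s h₃ (A.comp p q pq h₁ f g) h = A.comp p qr s h₄ f (A.comp q r qr h₂ g h)

/-- The DG category with differential `m₁` and composition `m₂`. -/
def toDGCat (h : A.IsDG) : DGCat k where
  Obj := A.Obj
  Hom := A.Hom
  d := A.d
  comp := A.comp
  one := A.one
  d_d := h.d_d
  leibniz := h.leibniz
  one_comp := h.one_comp
  comp_one := h.comp_one
  assoc := h.assoc

end AInfOps

/-! ### The deformed exterior algebra on two generators and the category `𝔆_θ` -/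

section ExteriorSide

variable {k : Type*} [Field k]

/-- Defining relations of `Λ_θ`. In characteristic other than two, `sq` is the case `i = j` of
`skew`; it is listed so that `Λ_θ` is a (deformed) exterior algebra over every field. -/
inductive LambdaRel (θ : Matrix (Fin 2) (Fin 2) kˣ) :
    FreeAlgebra k (Fin 2) → FreeAlgebra k (Fin 2) → Prop
  | skew (i j : Fin 2) : LambdaRel θ
      ((θ i j : k) • (FreeAlgebra.ι k i * FreeAlgebra.ι k j) +
        (θ j i : k) • (FreeAlgebra.ι k j * FreeAlgebra.ι k i)) 0
  | sq (i : Fin 2) : LambdaRel θ (FreeAlgebra.ι k i * FreeAlgebra.ι k i) 0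

/-- `Λ_θ`: generators `y₀, y₁`, relations `θᵢⱼ yᵢ yⱼ + θⱼᵢ yⱼ yᵢ = 0`. -/
abbrev LambdaAlg (θ : Matrix (Fin 2) (Fin 2) kˣ) : Type _ := RingQuot (LambdaRel θ)

def lambdaGen (θ : Matrix (Fin 2) (Fin 2) kˣ) (i : Fin 2) : LambdaAlg θ :=
  RingQuot.mkAlgHom k (LambdaRel θ) (FreeAlgebra.ι k i)

/-- The internal degree of a word in `y₀, y₁`, where `y₀` has degree `-a` and `y₁` degree `-b`. -/
def wordWeight (a b : ℕ) (w : List (Fin 2)) : ℤ :=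
  (w.map ![-(a : ℤ), -(b : ℤ)]).sum

/-- The bihomogeneous piece `(Λ_θ)^p_i` of cohomological degree `p` (each `yⱼ` has degree `1`) and
internal degree `i`: the span of the words of length `p` and internal degree `i`. -/
def lambdaPiece (a b : ℕ) (θ : Matrix (Fin 2) (Fin 2) kˣ) (p i : ℤ) :
    Submodule k (LambdaAlg θ) :=
  Submodule.span k {x | ∃ w : List (Fin 2),
    (w.length : ℤ) = p ∧ wordWeight a b w = i ∧ x = (w.map (lambdaGen θ)).prod}

theorem lambdaPiece_mul (a b : ℕ) (θ : Matrix (Fin 2) (Fin 2) kˣ) {p q r i j l : ℤ}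
    (hr : p + q = r) (hl : i + j = l) {x y : LambdaAlg θ}
    (hx : x ∈ lambdaPiece a b θ p i) (hy : y ∈ lambdaPiece a b θ q j) :
    x * y ∈ lambdaPiece a b θ r l := by
  have h := Submodule.mul_mem_mul hx hy
  rw [lambdaPiece, lambdaPiece, Submodule.span_mul_span] at h
  refine Submodule.span_mono ?_ h
  rintro _ ⟨_, ⟨v, hv, hv', rfl⟩, _, ⟨w, hw, hw', rfl⟩, rfl⟩
  refine ⟨v ++ w, ?_, ?_, ?_⟩
  · rw [List.length_append]; push_cast; omega
  · rw [← hl, ← hv', ← hw']; simp [wordWeight]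
  · simp

theorem one_mem_lambdaPiece (a b : ℕ) (θ : Matrix (Fin 2) (Fin 2) kˣ) {i : ℤ} (hi : 0 = i) :
    (1 : LambdaAlg θ) ∈ lambdaPiece a b θ 0 i :=
  Submodule.subset_span ⟨[], by simp, by simpa [wordWeight] using hi, by simp⟩

/-- The DG category `𝔆_θ`: objects `w₀, …, w_{a+b-1}`, morphisms `Hom(wⱼ, wᵢ) = (Λ_θ)_{i-j}`, zero
differential; the composite of `f : X ⟶ Y` and `g : Y ⟶ Z` is the product `g * f` in `Λ_θ`. -/
abbrev frakC (a b : ℕ) (θ : Matrix (Fin 2) (Fin 2) kˣ) : DGCat k where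
  Obj := Fin (a + b)
  Hom X Y p := lambdaPiece a b θ p ((Y : ℤ) - (X : ℤ))
  d _ _ _ := 0
  comp {X Y Z} p q r h := LinearMap.mk₂ k
    (fun f g => ⟨(g : LambdaAlg θ) * f, lambdaPiece_mul a b θ (by omega) (by omega) g.2 f.2⟩)
    (fun _ _ _ => Subtype.ext (mul_add _ _ _))
    (fun _ _ _ => Subtype.ext (mul_smul_comm _ _ _))
    (fun _ _ _ => Subtype.ext (add_mul _ _ _))
    (fun _ _ _ => Subtype.ext (smul_mul_assoc _ _ _))
  one X := ⟨1, one_mem_lambdaPiece a b θ (by omega)⟩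
  d_d _ _ _ _ _ _ := rfl
  leibniz _ _ _ _ _ _ := by
    simp only [LinearMap.zero_apply, map_zero]
    exact ((zero_add _).trans (smul_zero _)).symm
  one_comp _ f := Subtype.ext (mul_one _)
  comp_one _ f := Subtype.ext (one_mul _)
  assoc _ _ _ _ _ _ _ _ _ _ _ _ _ := Subtype.ext (mul_assoc _ _ _).symm

end ExteriorSide

/-! ### The Landau–Ginzburg model and its vanishing cycles -/

namespace MirrorLine

open Set Metric

/-- The curve `X = {x^a y^b = 1}` in `(ℂ^*)²`. -/
def curve (a b : ℕ) : Set (ℂ × ℂ) := {p | p.1 ≠ 0 ∧ p.2 ≠ 0 ∧ p.1 ^ a * p.2 ^ b = 1}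

/-- The superpotential `W = x + y`. -/
def W (p : ℂ × ℂ) : ℂ := p.1 + p.2

/-- Critical points of `W` restricted to `X`: the differential of `W` vanishes on the tangent
line of `X`, i.e. on the kernel of the differential of the defining equation. -/
def IsCritical (a b : ℕ) (p : ℂ × ℂ) : Prop :=
  p ∈ curve a b ∧ ∀ v : ℂ × ℂ,
    fderiv ℂ (fun q : ℂ × ℂ => q.1 ^ a * q.2 ^ b) p v = 0 → fderiv ℂ W p v = 0

/-- The critical value `λ_j = λ_0 ζ^{-j}`, where `λ_0` is the positive real root of
`λ^{a+b} = (a+b)^{a+b} / (a^a b^b)` and `ζ = exp (2πi/(a+b))`. -/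
def critValue (a b : ℕ) (j : ℕ) : ℂ :=
  (((((a : ℝ) + b) ^ (a + b) / ((a : ℝ) ^ a * (b : ℝ) ^ b)) ^ (1 / ((a : ℝ) + b)) : ℝ) : ℂ) *
    Complex.exp (-(2 * Real.pi * Complex.I * j / ((a : ℂ) + b)))

/-- The reference fiber `Σ_0 = W⁻¹(0)`, a finite set of points. -/
def refFiber (a b : ℕ) : Set (ℂ × ℂ) := {p | p ∈ curve a b ∧ W p = 0}

/-- The Lefschetz thimble over the segment `γ_j = {t λ_j : 0 ≤ t ≤ 1}`: all points on lifts of `γ_j`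
to `X` that end at a critical point. The fibers of `W` are zero-dimensional, so the horizontal
distribution (the symplectic orthogonal of the fibers) is the full tangent space, whatever the
symplectic form, and parallel transport is the lifting of paths. -/
def thimble (a b j : ℕ) : Set (ℂ × ℂ) :=
  {p | ∃ u : ℝ → ℂ × ℂ, ContinuousOn u (Icc 0 1) ∧
    (∀ t ∈ Icc (0 : ℝ) 1, u t ∈ curve a b ∧ W (u t) = t * critValue a b j) ∧
    IsCritical a b (u 1) ∧ ∃ t ∈ Icc (0 : ℝ) 1, u t = p}

/-- The vanishing cycle `L_j`: the boundary of the thimble, which is its part over `0`. -/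
def vanishingCycle (a b j : ℕ) : Set (ℂ × ℂ) := thimble a b j ∩ refFiber a b

/-- The holomorphic volume form of `X`: on tangent vectors of `X`, `dx / (b x)` is the residue of
`d log x ∧ d log y`, that is, `Ω ∧ d(x^a y^b) = d log x ∧ d log y` along `X`. -/
def volForm (b : ℕ) (p v : ℂ × ℂ) : ℂ := v.1 / (b * p.1)

/-- `φ` is a grading of `L_j` induced by a graded lift of the thimble `D_j`. Here `c` is a regular
parametrization of the arc `D_j`, `Φ` is a real lift of its phase `arg Ω(c')`, and `α` is an
argument of the direction of `γ_j`. The volume form of the fiber is `Ω / dW`, so the phase of `L_j`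
at the two boundary points of `D_j` is the phase of `D_j` minus `α`. For given `j` two such
gradings differ on `L_j` by a constant in `πℤ` (a shift). -/
def IsGrading (a b j : ℕ) (φ : ℂ × ℂ → ℝ) : Prop :=
  ∃ (c : ℝ → ℂ × ℂ) (Φ : ℝ → ℝ) (α : ℝ),
    ContDiffOn ℝ 1 c (Icc (-1) 1) ∧
    (∀ s ∈ Icc (-1 : ℝ) 1, derivWithin c (Icc (-1) 1) s ≠ 0) ∧
    InjOn c (Icc (-1) 1) ∧
    c '' Icc (-1) 1 = thimble a b j ∧
    ContinuousOn Φ (Icc (-1) 1) ∧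
    (∀ s ∈ Icc (-1 : ℝ) 1,
      volForm b (c s) (derivWithin c (Icc (-1) 1) s) =
        ‖volForm b (c s) (derivWithin c (Icc (-1) 1) s)‖ * Complex.exp (Φ s * Complex.I)) ∧
    critValue a b j = ‖critValue a b j‖ * Complex.exp (α * Complex.I) ∧
    φ (c (-1)) = Φ (-1) - α ∧ φ (c 1) = Φ 1 - α

/-! ### Floer complexes -/

/-- Generators of `Hom(L_i, L_j)`: for `i < j` the points of `L_i ∩ L_j` (as `some p`), for `i = j`
the identity (as `none`), and nothing for `i > j`. -/
def IsGen (a b : ℕ) (i j : Fin (a + b)) : Option (ℂ × ℂ) → Prop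
  | none => i = j
  | some p => i < j ∧ p ∈ vanishingCycle a b i ∧ p ∈ vanishingCycle a b j

/-- A generator has degree `n`: the Maslov index of a point `p` of `L_i ∩ L_j` is the difference
of the phases of `L_j` and `L_i` at `p`, divided by `π`; identities have degree zero. -/
def HasDegree (a b : ℕ) (φ : Fin (a + b) → ℂ × ℂ → ℝ) (i j : Fin (a + b)) :
    Option (ℂ × ℂ) → ℤ → Prop
  | none, n => n = 0
  | some p, n => φ j p - φ i p = n * Real.pi

/-- Generators of `Hom(L_i, L_j)` of degree `n`. -/
abbrev Gen (a b : ℕ) (φ : Fin (a + b) → ℂ × ℂ → ℝ) (i j : Fin (a + b)) (n : ℤ) : Type :=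
  {o : Option (ℂ × ℂ) // IsGen a b i j o ∧ HasDegree a b φ i j o n}

/-- The point of the unit circle with angle `t`. -/
def circ (t : ℝ) : ℂ := Complex.exp (t * Complex.I)

/-- Holomorphic maps from the closed unit disc to `Σ_0`, with `n + 1` cyclically ordered boundary
points at the angles `t 0 < ⋯ < t n < t 0 + 2π`; the successive boundary arcs are mapped to
`L_{I 0}, …, L_{I n}`, the corner between the arcs for `I s` and `I (s + 1)` to the input `o s`, and
the corner between the last and the first arc to the output `q`. (The zero-dimensional manifold
`Σ_0` has only one almost complex structure.) -/
structure Disc (a b : ℕ) {n : ℕ} (I : Fin (n + 1) → Fin (a + b)) (o : Fin n → Option (ℂ × ℂ))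
    (q : Option (ℂ × ℂ)) where
  t : Fin (n + 1) → ℝ
  u : ℂ → ℂ × ℂ
  strictMono : StrictMono t
  lt_two_pi : t (Fin.last n) < t 0 + 2 * Real.pi
  holomorphic : DiffContOnCl ℂ u (ball 0 1)
  mem_fiber : ∀ z ∈ closedBall (0 : ℂ) 1, u z ∈ refFiber a b
  arc : ∀ (s : Fin n), ∀ x ∈ Icc (t s.castSucc) (t s.succ),
    u (circ x) ∈ vanishingCycle a b (I s.castSucc)
  arc_last : ∀ x ∈ Icc (t (Fin.last n)) (t 0 + 2 * Real.pi),
    u (circ x) ∈ vanishingCycle a b (I (Fin.last n))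
  corner : ∀ s : Fin n, o s = some (u (circ (t s.succ)))
  corner_zero : q = some (u (circ (t 0)))

/-- Two marked discs are identified if they differ by an automorphism
`z ↦ e^{iβ} (z - w) / (1 - w̄ z)`, `|w| < 1`, of the unit disc. -/
def Disc.Rel (a b : ℕ) {n : ℕ} (I : Fin (n + 1) → Fin (a + b)) (o : Fin n → Option (ℂ × ℂ))
    (q : Option (ℂ × ℂ)) (D D' : Disc a b I o q) : Prop :=
  ∃ (β : ℝ) (w : ℂ), ‖w‖ < 1 ∧
    (∀ z ∈ closedBall (0 : ℂ) 1,
      D'.u (circ β * ((z - w) / (1 - (starRingEnd ℂ) w * z))) = D.u z) ∧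
    ∀ s, circ (D'.t s) =
      circ β * ((circ (D.t s) - w) / (1 - (starRingEnd ℂ) w * circ (D.t s)))

/-- The moduli space of marked discs with given boundary conditions and corners. -/
abbrev Moduli (a b : ℕ) {n : ℕ} (I : Fin (n + 1) → Fin (a + b)) (o : Fin n → Option (ℂ × ℂ))
    (q : Option (ℂ × ℂ)) : Type :=
  Quot (Disc.Rel a b I o q)

/-- The symplectic area `∫_{D²} u^* ω`, where the 2-form `ω` on `X` is given by a field of
alternating forms on the ambient space. -/
def area (ω : ℂ × ℂ → (ℂ × ℂ) [⋀^Fin 2]→L[ℝ] ℝ) (u : ℂ → ℂ × ℂ) : ℝ :=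
  ∫ z in ball (0 : ℂ) 1, ω (u z) ![fderiv ℝ u z 1, fderiv ℝ u z Complex.I]

/-- A choice of signs (orientations) for all the points of the moduli spaces. -/
abbrev Signs (a b : ℕ) : Type :=
  ∀ (n : ℕ) (I : Fin (n + 1) → Fin (a + b)) (o : Fin n → Option (ℂ × ℂ)) (q : Option (ℂ × ℂ)),
    Moduli a b I o q → ℤˣ

open Classical in
/-- Structure constants of the operations `m_n`. For `i_0 < ⋯ < i_n`, the count of the discs, each
with its sign and with the weight `τ` of its area. Otherwise `0`, except that `m_2` with an
identity (`none`) as one of its two arguments returns the other argument. -/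
def coeff {k : Type*} [Field k] (a b : ℕ) (ω : ℂ × ℂ → (ℂ × ℂ) [⋀^Fin 2]→L[ℝ] ℝ)
    (τ : Multiplicative ℝ →* kˣ) (ε : Signs a b) {n : ℕ} (I : Fin (n + 1) → Fin (a + b))
    (o : Fin n → Option (ℂ × ℂ)) (q : Option (ℂ × ℂ)) : k :=
  if StrictMono I then
    ∑ᶠ D : Moduli a b I o q,
      ((ε n I o q D : ℤ) : k) * (τ (Multiplicative.ofAdd (area ω D.out.u)) : k)
  else if n = 2 ∧ ∃ s s' : Fin n, s ≠ s' ∧ o s = none ∧ o s' = q then 1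
  else 0

/-- The directed category of vanishing cycles `Lag_vc(W, {γ_j})` with coefficients in `k`, given its
gradings `φ`. Its objects are `L_0, …, L_{a+b-1}`, its morphism spaces are free on the generators,
and `m_n` is given on generators by the structure constants, where only outputs of degree
`∑ deg + 2 - n` (moduli spaces of expected dimension zero) are taken into account. The sums are
finite because `Σ_0` is. -/
abbrev lagVC {k : Type*} [Field k] (a b : ℕ) (φ : Fin (a + b) → ℂ × ℂ → ℝ)
    (ω : ℂ × ℂ → (ℂ × ℂ) [⋀^Fin 2]→L[ℝ] ℝ) (τ : Multiplicative ℝ →* kˣ) (ε : Signs a b) :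
    AInfOps k where
  Obj := Fin (a + b)
  Hom i j n := Gen a b φ i j n →₀ k
  one _ := Finsupp.single ⟨none, rfl, rfl⟩ 1
  m n I e r _ :=
    ∑ᶠ (g : ∀ s : Fin n, Gen a b φ (I s.castSucc) (I s.succ) (e s))
      (q : Gen a b φ (I 0) (I (Fin.last n)) r),
      ((MultilinearMap.mkPiAlgebra k (Fin n) k).compLinearMap
        (fun s => Finsupp.lapply (g s))).smulRight
          (Finsupp.single q (coeff a b ω τ ε I (fun s => (g s).1) q.1))

end MirrorLine

end

noncomputable section

namespace MirrorLine

open Set Metric Filter Topology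

/-! ### Explicit parametrization of the thimbles -/

/-- The smooth function `sin (n ψ) / sin ψ`. -/
def sinRatio (n : ℕ) (ψ : ℝ) : ℝ := (Polynomial.Chebyshev.U ℝ ((n : ℤ) - 1)).eval (Real.cos ψ)

theorem sinRatio_mul_sin (n : ℕ) (ψ : ℝ) : sinRatio n ψ * Real.sin ψ = Real.sin (n * ψ) := by
  rw [sinRatio, Polynomial.Chebyshev.U_real_cos]
  push_cast
  ring_nf

theorem sinRatio_zero (n : ℕ) : sinRatio n 0 = n := by
  rw [sinRatio, Real.cos_zero, Polynomial.Chebyshev.U_eval_one]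
  push_cast
  ring

theorem sinRatio_neg (n : ℕ) (ψ : ℝ) : sinRatio n (-ψ) = sinRatio n ψ := by
  rw [sinRatio, sinRatio, Real.cos_neg]

theorem contDiff_sinRatio (n : ℕ) : ContDiff ℝ 1 (sinRatio n) := by
  unfold sinRatio
  simp_rw [← Polynomial.coe_aeval_eq_eval]
  exact (Polynomial.contDiff_aeval _ 1).comp Real.contDiff_cos

theorem sinRatio_pos {n : ℕ} (hn : 0 < n) {ψ : ℝ} (h : n * |ψ| < Real.pi) : 0 < sinRatio n ψ := by
  have key : ∀ x : ℝ, 0 ≤ x → n * x < Real.pi → 0 < sinRatio n x := by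
    intro x hx h
    have hn' : (1 : ℝ) ≤ n := by exact_mod_cast hn
    rcases hx.eq_or_lt with rfl | hx
    · rw [sinRatio_zero]; linarith
    · have h1 : 0 < Real.sin x := Real.sin_pos_of_pos_of_lt_pi hx (by nlinarith)
      have h2 : 0 < Real.sin (n * x) := Real.sin_pos_of_pos_of_lt_pi (by positivity) h
      rw [← sinRatio_mul_sin] at h2
      exact pos_of_mul_pos_left h2 h1.le
  rcases abs_cases ψ with ⟨h1, h2⟩ | ⟨h1, h2⟩
  · exact key ψ h2 (h1 ▸ h)
  · rw [← sinRatio_neg]; exact key _ (by linarith) (h1 ▸ h)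

/-- The angle at the boundary points of the thimbles. -/
def endAngle (a b : ℕ) : ℝ := Real.pi / ((a : ℝ) + b)

/-- The logarithm of the modulus of `x^{1/b} = y^{-1/a}` along the thimble. -/
def logModulus (a b : ℕ) (ψ : ℝ) : ℝ :=
  Real.log (sinRatio a ψ / sinRatio b ψ) / ((a : ℝ) + b)

/-- A logarithm of `x^{1/b} = y^{-1/a}` along the thimble `D_0`. -/
def arcLog (a b : ℕ) (ψ : ℝ) : ℂ := logModulus a b ψ + ψ * Complex.I

/-- The explicit parametrization of the thimble `D_0` by the angle `ψ`. -/
def modelArc (a b : ℕ) (ψ : ℝ) : ℂ × ℂ :=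
  (Complex.exp (b * arcLog a b ψ), Complex.exp (-(a * arcLog a b ψ)))

/-- The value of `W` along the standard arc. -/
def height (a b : ℕ) (ψ : ℝ) : ℝ :=
  Real.exp (b * logModulus a b ψ) * Real.cos (b * ψ) +
    Real.exp (-(a * logModulus a b ψ)) * Real.cos (a * ψ)

/-- The positive critical value `λ_0`. -/
def critRadius (a b : ℕ) : ℝ :=
  (((a : ℝ) + b) ^ (a + b) / ((a : ℝ) ^ a * (b : ℝ) ^ b)) ^ (1 / ((a : ℝ) + b))

section

variable {a b : ℕ}

theorem endAngle_pos (ha : 0 < a) : 0 < endAngle a b := by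
  have := Real.pi_pos
  have : (0 : ℝ) < a := by exact_mod_cast ha
  unfold endAngle
  positivity

theorem add_mul_endAngle (ha : 0 < a) : ((a : ℝ) + b) * endAngle a b = Real.pi := by
  have : (0 : ℝ) < a := by exact_mod_cast ha
  unfold endAngle
  field_simp

theorem left_mul_lt_pi (ha : 0 < a) (hb : 0 < b) {ψ : ℝ} (h : |ψ| ≤ endAngle a b) :
    a * |ψ| < Real.pi := by
  have h1 : (0 : ℝ) < a := by exact_mod_cast ha
  have h2 : (0 : ℝ) < b := by exact_mod_cast hb
  have := add_mul_endAngle (b := b) ha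
  nlinarith [endAngle_pos (b := b) ha]

theorem right_mul_lt_pi (ha : 0 < a) (_hb : 0 < b) {ψ : ℝ} (h : |ψ| ≤ endAngle a b) :
    b * |ψ| < Real.pi := by
  have h1 : (0 : ℝ) < a := by exact_mod_cast ha
  have := add_mul_endAngle (b := b) ha
  nlinarith [endAngle_pos (b := b) ha]

theorem contDiffAt_logModulus (ha : 0 < a) (hb : 0 < b) {ψ : ℝ} (h : |ψ| ≤ endAngle a b) :
    ContDiffAt ℝ 1 (logModulus a b) ψ := by
  have h1 := sinRatio_pos ha (left_mul_lt_pi ha hb h)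
  have h2 := sinRatio_pos hb (right_mul_lt_pi ha hb h)
  exact (((contDiff_sinRatio a).contDiffAt.div (contDiff_sinRatio b).contDiffAt h2.ne').log
    (div_pos h1 h2).ne').div_const _

theorem exp_logModulus (ha : 0 < a) (hb : 0 < b) {ψ : ℝ} (h : |ψ| ≤ endAngle a b) :
    Real.exp (((a : ℝ) + b) * logModulus a b ψ) = sinRatio a ψ / sinRatio b ψ := by
  have h0 : (0 : ℝ) < a := by exact_mod_cast ha
  have h1 := sinRatio_pos ha (left_mul_lt_pi ha hb h)
  have h2 := sinRatio_pos hb (right_mul_lt_pi ha hb h)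
  rw [logModulus, mul_div_cancel₀ _ (by positivity), Real.exp_log (div_pos h1 h2)]

/-- The condition `Im (x + y) = 0` with denominators cleared, so that it also covers `ψ = 0`. Every
computation along the arc starts from this form. -/
theorem exp_logModulus_mul_sin (ha : 0 < a) (hb : 0 < b) {ψ : ℝ} (h : |ψ| ≤ endAngle a b) :
    Real.exp (((a : ℝ) + b) * logModulus a b ψ) * Real.sin (b * ψ) = Real.sin (a * ψ) := by
  have h2 := sinRatio_pos hb (right_mul_lt_pi ha hb h)
  rw [exp_logModulus ha hb h, ← sinRatio_mul_sin, ← sinRatio_mul_sin]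
  field_simp

theorem logModulus_neg (ψ : ℝ) : logModulus a b (-ψ) = logModulus a b ψ := by
  rw [logModulus, logModulus, sinRatio_neg, sinRatio_neg]

theorem height_neg (ψ : ℝ) : height a b (-ψ) = height a b ψ := by
  rw [height, height, logModulus_neg, mul_neg, mul_neg, Real.cos_neg, Real.cos_neg]

theorem modelArc_mul (ψ : ℝ) : (modelArc a b ψ).1 ^ a * (modelArc a b ψ).2 ^ b = 1 := by
  rw [modelArc, ← Complex.exp_nat_mul, ← Complex.exp_nat_mul, ← Complex.exp_add,
    Complex.exp_eq_one_iff]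
  exact ⟨0, by push_cast; ring⟩

theorem modelArc_fst (ψ : ℝ) : (modelArc a b ψ).1 =
    (Real.exp (b * logModulus a b ψ) : ℝ) * Complex.exp ((b * ψ : ℝ) * Complex.I) := by
  rw [modelArc, arcLog]
  push_cast
  rw [← Complex.exp_add]
  ring_nf

theorem modelArc_snd (ψ : ℝ) : (modelArc a b ψ).2 =
    (Real.exp (-(a * logModulus a b ψ)) : ℝ) * Complex.exp ((-(a * ψ) : ℝ) * Complex.I) := by
  rw [modelArc, arcLog]
  push_cast
  rw [← Complex.exp_add]
  ring_nf

theorem modelArc_add (ha : 0 < a) (hb : 0 < b) {ψ : ℝ} (h : |ψ| ≤ endAngle a b) :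
    (modelArc a b ψ).1 + (modelArc a b ψ).2 = height a b ψ := by
  have key := exp_logModulus_mul_sin ha hb h
  rw [add_mul, Real.exp_add] at key
  have key2 : Real.exp (b * logModulus a b ψ) * Real.sin (b * ψ) =
      Real.exp (-(a * logModulus a b ψ)) * Real.sin (a * ψ) := by
    rw [← key, Real.exp_neg]
    field_simp
  have key3 := congrArg ((↑) : ℝ → ℂ) key2
  rw [modelArc_fst, modelArc_snd, Complex.exp_mul_I, Complex.exp_mul_I, ← Complex.ofReal_cos,
    ← Complex.ofReal_cos, ← Complex.ofReal_sin, ← Complex.ofReal_sin, Real.cos_neg, Real.sin_neg,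
    height]
  rw [Complex.ofReal_mul, Complex.ofReal_mul] at key3
  rw [Complex.ofReal_add, Complex.ofReal_mul, Complex.ofReal_mul, Complex.ofReal_neg]
  linear_combination Complex.I * key3

/-- At `ψ = π/(a+b)` the angles `aψ` and `bψ` are supplementary, so their sines agree. Their cosines
are opposite, which is why the height vanishes there. -/
theorem logModulus_endAngle (ha : 0 < a) (hb : 0 < b) : logModulus a b (endAngle a b) = 0 := by
  have hs := add_mul_endAngle (b := b) ha
  have h1 : (a : ℝ) * endAngle a b = Real.pi - b * endAngle a b := by linarith
  have h2 : 0 < Real.sin (b * endAngle a b) := by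
    have hb' : (0 : ℝ) < b := by exact_mod_cast hb
    have ha' : (0 : ℝ) < a := by exact_mod_cast ha
    have := endAngle_pos (b := b) ha
    exact Real.sin_pos_of_pos_of_lt_pi (by positivity) (by nlinarith)
  have h := exp_logModulus_mul_sin ha hb (le_of_eq (abs_of_pos (endAngle_pos (b := b) ha)))
  rw [h1, Real.sin_pi_sub, mul_eq_right₀ h2.ne', Real.exp_eq_one_iff] at h
  have ha' : (0 : ℝ) < a := by exact_mod_cast ha
  exact (mul_eq_zero.1 h).resolve_left (by positivity)

theorem height_endAngle (ha : 0 < a) (hb : 0 < b) : height a b (endAngle a b) = 0 := by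
  have hs := add_mul_endAngle (b := b) ha
  have h1 : (a : ℝ) * endAngle a b = Real.pi - b * endAngle a b := by linarith
  rw [height, logModulus_endAngle ha hb, h1, Real.cos_pi_sub]
  simp

theorem critRadius_pos (ha : 0 < a) (hb : 0 < b) : 0 < critRadius a b := by
  have ha' : (0 : ℝ) < a := by exact_mod_cast ha
  have hb' : (0 : ℝ) < b := by exact_mod_cast hb
  unfold critRadius
  positivity

theorem exp_logModulus_zero (ha : 0 < a) (hb : 0 < b) :
    Real.exp (((a : ℝ) + b) * logModulus a b 0) = a / b := by
  rw [exp_logModulus ha hb (by simpa using (endAngle_pos ha).le), sinRatio_zero, sinRatio_zero]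

theorem mul_exp_logModulus_zero (ha : 0 < a) (hb : 0 < b) :
    b * Real.exp (b * logModulus a b 0) = a * Real.exp (-(a * logModulus a b 0)) := by
  have hb' : (0 : ℝ) < b := by exact_mod_cast hb
  have h := exp_logModulus_zero ha hb
  rw [add_mul, Real.exp_add, eq_div_iff hb'.ne'] at h
  have h1 : Real.exp (a * logModulus a b 0) * Real.exp (-(a * logModulus a b 0)) = 1 := by
    rw [← Real.exp_add, add_neg_cancel, Real.exp_zero]
  linear_combination Real.exp (-(a * logModulus a b 0)) * h -
    b * Real.exp (b * logModulus a b 0) * h1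

/-- At the critical point `bx = ay`, so `x + y = (a+b)/b · y`, and `y^{a+b} = (b/a)^a`. Raising to
the power `a+b` gives the equation defining `λ_0`. -/
theorem height_zero (ha : 0 < a) (hb : 0 < b) : height a b 0 = critRadius a b := by
  have ha' : (0 : ℝ) < a := by exact_mod_cast ha
  have hb' : (0 : ℝ) < b := by exact_mod_cast hb
  have h1 := mul_exp_logModulus_zero ha hb
  set E := Real.exp (-(a * logModulus a b 0)) with hE
  have hEpos : 0 < E := Real.exp_pos _
  have h2 : height a b 0 = (a + b) / b * E := by
    rw [height, mul_zero, mul_zero, Real.cos_zero, mul_one, mul_one, ← hE]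
    field_simp
    linarith
  have h3 : E ^ (a + b) = (b / a : ℝ) ^ a := by
    rw [hE, ← Real.exp_nat_mul, ← inv_div, ← exp_logModulus_zero ha hb, ← Real.exp_neg,
      ← Real.exp_nat_mul]
    push_cast
    ring_nf
  have h4 : height a b 0 ^ (a + b) =
      ((a : ℝ) + b) ^ (a + b) / ((a : ℝ) ^ a * (b : ℝ) ^ b) := by
    rw [h2, mul_pow, h3, div_pow, div_pow, pow_add (b : ℝ)]
    field_simp
  rw [critRadius, ← h4, one_div, ← Nat.cast_add, Real.pow_rpow_inv_natCast]
  · rw [h2]; positivity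
  · omega

/-! ### Derivatives along the arc and monotonicity of the height. -/

theorem hasDerivAt_arcLog (ha : 0 < a) (hb : 0 < b) {ψ : ℝ} (h : |ψ| ≤ endAngle a b) :
    HasDerivAt (arcLog a b) (((deriv (logModulus a b) ψ : ℝ) : ℂ) + Complex.I) ψ := by
  have h1 := ((contDiffAt_logModulus ha hb h).differentiableAt one_ne_zero).hasDerivAt.ofReal_comp
  have h2 := (Complex.ofRealCLM.hasDerivAt (x := ψ)).mul_const Complex.I
  exact (h1.add h2).congr_deriv (by simp)

theorem contDiffAt_arcLog (ha : 0 < a) (hb : 0 < b) {ψ : ℝ} (h : |ψ| ≤ endAngle a b) :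
    ContDiffAt ℝ 1 (arcLog a b) ψ := by
  have h1 := Complex.ofRealCLM.contDiff.contDiffAt.comp ψ (contDiffAt_logModulus ha hb h)
  exact h1.add (Complex.ofRealCLM.contDiff.contDiffAt.mul contDiffAt_const)

theorem contDiffAt_modelArc (ha : 0 < a) (hb : 0 < b) {ψ : ℝ} (h : |ψ| ≤ endAngle a b) :
    ContDiffAt ℝ 1 (modelArc a b) ψ := by
  have h1 := contDiffAt_arcLog ha hb h
  exact (contDiffAt_const.mul h1).cexp.prodMk (contDiffAt_const.mul h1).neg.cexp

theorem continuousAt_modelArc (ha : 0 < a) (hb : 0 < b) {ψ : ℝ} (h : |ψ| ≤ endAngle a b) :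
    ContinuousAt (modelArc a b) ψ :=
  (contDiffAt_modelArc ha hb h).continuousAt

theorem hasDerivAt_modelArc_fst (ha : 0 < a) (hb : 0 < b) {ψ : ℝ} (h : |ψ| ≤ endAngle a b) :
    HasDerivAt (fun s => (modelArc a b s).1)
      ((modelArc a b ψ).1 * (b * (((deriv (logModulus a b) ψ : ℝ) : ℂ) + Complex.I))) ψ :=
  ((hasDerivAt_arcLog ha hb h).const_mul (b : ℂ)).cexp

theorem hasDerivAt_modelArc_snd (ha : 0 < a) (hb : 0 < b) {ψ : ℝ} (h : |ψ| ≤ endAngle a b) :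
    HasDerivAt (fun s => (modelArc a b s).2)
      ((modelArc a b ψ).2 * -(a * (((deriv (logModulus a b) ψ : ℝ) : ℂ) + Complex.I))) ψ :=
  ((hasDerivAt_arcLog ha hb h).const_mul (a : ℂ)).neg.cexp

theorem contDiffAt_height (ha : 0 < a) (hb : 0 < b) {ψ : ℝ} (h : |ψ| ≤ endAngle a b) :
    ContDiffAt ℝ 1 (height a b) ψ := by
  have h1 := contDiffAt_logModulus ha hb h
  unfold height
  exact ((contDiffAt_const.mul h1).exp.mul (contDiffAt_const.mul contDiffAt_id).cos).add
    ((contDiffAt_const.mul h1).neg.exp.mul (contDiffAt_const.mul contDiffAt_id).cos)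

/-- The derivative is `(v' + i)(bx - ay)`, whose first factor is never zero. If `bx = ay`, then `x/y
= e^{(a+b)z}` is a positive real, contradicting `sin((a+b)ψ) > 0` for `0 < ψ < π/(a+b)`. -/
theorem deriv_height_ne_zero (ha : 0 < a) (hb : 0 < b) {ψ : ℝ} (h0 : 0 < ψ)
    (h : ψ < endAngle a b) : deriv (height a b) ψ ≠ 0 := by
  intro hd
  have habs : |ψ| ≤ endAngle a b := by rw [abs_of_pos h0]; exact h.le
  have h1 := (hasDerivAt_modelArc_fst ha hb habs).add (hasDerivAt_modelArc_snd ha hb habs)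
  have h2 := ((contDiffAt_height ha hb habs).differentiableAt one_ne_zero).hasDerivAt.ofReal_comp
  have hev : (fun s => (height a b s : ℂ)) =ᶠ[𝓝 ψ]
      ((fun s => (modelArc a b s).1) + fun s => (modelArc a b s).2) := by
    filter_upwards [Ioo_mem_nhds h0 h] with s hs
    exact (modelArc_add ha hb (by rw [abs_of_pos hs.1]; exact hs.2.le)).symm
  have h3 := h1.unique (h2.congr_of_eventuallyEq hev.symm)
  rw [hd] at h3
  have h4 : (((deriv (logModulus a b) ψ : ℝ) : ℂ) + Complex.I) *
      (b * (modelArc a b ψ).1 - a * (modelArc a b ψ).2) = 0 := by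
    rw [Complex.ofReal_zero] at h3
    linear_combination h3
  rcases mul_eq_zero.1 h4 with h5 | h5
  · simpa using congrArg Complex.im h5
  · have ha' : (0 : ℝ) < a := by exact_mod_cast ha
    have hb' : (0 : ℝ) < b := by exact_mod_cast hb
    have h6 : Complex.exp (((a + b : ℝ) * ψ : ℝ) * Complex.I) =
        ((a / b * Real.exp (-(a + b : ℝ) * logModulus a b ψ) : ℝ) : ℂ) := by
      have e1 : Complex.exp (((a + b : ℝ) * ψ : ℝ) * Complex.I) =
          (modelArc a b ψ).1 * Complex.exp (a * arcLog a b ψ) *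
            (Real.exp (-(a + b : ℝ) * logModulus a b ψ) : ℝ) := by
        rw [modelArc, Complex.ofReal_exp, ← Complex.exp_add, ← Complex.exp_add, arcLog]
        push_cast
        ring_nf
      have e2 : (modelArc a b ψ).2 * Complex.exp (a * arcLog a b ψ) = 1 := by
        rw [modelArc, ← Complex.exp_add, neg_add_cancel, Complex.exp_zero]
      have e3 : (modelArc a b ψ).1 * Complex.exp (a * arcLog a b ψ) = a / b := by
        rw [eq_div_iff (by exact_mod_cast hb.ne')]
        linear_combination Complex.exp (a * arcLog a b ψ) * h5 + a * e2
      rw [e1, e3]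
      push_cast
      ring
    have h7 := congrArg Complex.im h6
    rw [Complex.exp_ofReal_mul_I_im, Complex.ofReal_im] at h7
    have h8 := add_mul_endAngle (b := b) ha
    have := Real.sin_pos_of_pos_of_lt_pi (x := (a + b : ℝ) * ψ) (by positivity) (by nlinarith)
    linarith

theorem continuousOn_height (ha : 0 < a) (hb : 0 < b) :
    ContinuousOn (height a b) (Icc 0 (endAngle a b)) := fun ψ hψ =>
  (contDiffAt_height ha hb (by rw [abs_of_nonneg hψ.1]; exact hψ.2)).continuousAt.continuousWithinAt

theorem strictAntiOn_height (ha : 0 < a) (hb : 0 < b) :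
    StrictAntiOn (height a b) (Icc 0 (endAngle a b)) := by
  have he := endAngle_pos (b := b) ha
  have hinj : InjOn (height a b) (Icc 0 (endAngle a b)) := by
    intro x hx y hy hxy
    by_contra hne
    wlog hlt : x < y generalizing x y
    · exact this hy hx hxy.symm (Ne.symm hne) (lt_of_le_of_ne (not_lt.1 hlt) (Ne.symm hne))
    obtain ⟨z, hz, hz'⟩ := exists_deriv_eq_zero hlt
      ((continuousOn_height ha hb).mono (Icc_subset_Icc hx.1 hy.2)) hxy
    exact deriv_height_ne_zero ha hb (hx.1.trans_lt hz.1) (hz.2.trans_le hy.2) hz'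
  -- Rolle gives injectivity, hence strict monotonicity one way or the other. The end values `λ_0`
  -- and `0` select the decreasing one.
  rcases ContinuousOn.strictMonoOn_of_injOn_Icc' he.le (continuousOn_height ha hb) hinj with h | h
  · have := h ⟨le_rfl, he.le⟩ ⟨he.le, le_rfl⟩ he
    rw [height_endAngle ha hb, height_zero ha hb] at this
    exact absurd this (critRadius_pos ha hb).le.not_gt
  · exact h

/-- The angle along the half thimble as a function of the height. -/
theorem exists_angle_of_height (ha : 0 < a) (hb : 0 < b) :
    ∃ θ : ℝ → ℝ, ContinuousOn θ (Icc 0 1) ∧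
      (∀ t ∈ Icc (0 : ℝ) 1, θ t ∈ Icc 0 (endAngle a b) ∧
        height a b (θ t) = t * critRadius a b) ∧
      θ 1 = 0 ∧ ∀ ψ ∈ Icc 0 (endAngle a b), ∃ t ∈ Icc (0 : ℝ) 1, θ t = ψ := by
  have he := endAngle_pos (b := b) ha
  have hR := critRadius_pos ha hb
  have hanti := strictAntiOn_height ha hb
  let f : Icc 0 (endAngle a b) → ℝ := fun ψ => height a b ψ / critRadius a b
  have hf : Continuous f := (continuousOn_iff_continuous_domRestrict.1
    (continuousOn_height ha hb)).div_const _
  have hfi : Function.Injective f := by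
    intro x y hxy
    have : height a b x = height a b y := by
      simpa [f, hR.ne'] using hxy
    exact Subtype.ext (hanti.injOn x.2 y.2 this)
  have hmem : ∀ ψ, f ψ ∈ Icc (0 : ℝ) 1 := by
    intro ψ
    have h1 := hanti.antitoneOn ⟨le_rfl, he.le⟩ ψ.2 ψ.2.1
    have h2 := hanti.antitoneOn ψ.2 ⟨he.le, le_rfl⟩ ψ.2.2
    rw [height_zero ha hb] at h1
    rw [height_endAngle ha hb] at h2
    exact ⟨div_nonneg h2 hR.le, (div_le_one hR).2 h1⟩
  have hsurj : ∀ t ∈ Icc (0 : ℝ) 1, t ∈ range f := by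
    intro t ht
    have := intermediate_value_Icc' he.le (continuousOn_height ha hb)
      (show t * critRadius a b ∈ _ by
        rw [height_endAngle ha hb, height_zero ha hb]
        exact ⟨mul_nonneg ht.1 hR.le, by nlinarith [ht.2]⟩)
    obtain ⟨ψ, hψ, hψ'⟩ := this
    exact ⟨⟨ψ, hψ⟩, by simp only [f]; rw [hψ']; field_simp⟩
  let F := (hf.isClosedEmbedding hfi).isEmbedding.toHomeomorph
  have hF : ∀ ψ, (F ψ : ℝ) = f ψ := fun _ => rfl
  let θ : ℝ → ℝ := fun t => if h : t ∈ Icc (0 : ℝ) 1 then (F.symm ⟨t, hsurj t h⟩ : ℝ) else 0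
  have hθ : ∀ t (ht : t ∈ Icc (0 : ℝ) 1), θ t = F.symm ⟨t, hsurj t ht⟩ := fun t ht => dif_pos ht
  have hθf : ∀ t (ht : t ∈ Icc (0 : ℝ) 1), f (F.symm ⟨t, hsurj t ht⟩) = t := by
    intro t ht
    rw [← hF, F.apply_symm_apply]
  have hinv : ∀ ψ, θ (f ψ) = ψ := by
    intro ψ
    rw [hθ _ (hmem ψ)]
    exact congrArg Subtype.val (F.symm_apply_apply ψ)
  refine ⟨θ, ?_, ?_, ?_, ?_⟩
  · rw [continuousOn_iff_continuous_domRestrict]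
    have : (Icc (0 : ℝ) 1).domRestrict θ = fun t : Icc (0 : ℝ) 1 => (F.symm ⟨t, hsurj t t.2⟩ : ℝ) := by
      ext t
      exact hθ t t.2
    rw [this]
    exact continuous_subtype_val.comp (F.symm.continuous.comp (by fun_prop))
  · intro t ht
    rw [hθ t ht]
    refine ⟨(F.symm _).2, ?_⟩
    have := hθf t ht
    simp only [f] at this
    rwa [div_eq_iff hR.ne'] at this
  · have := hinv ⟨0, le_rfl, he.le⟩
    simp only [f, height_zero ha hb, div_self hR.ne'] at this
    exact this
  · intro ψ hψ
    exact ⟨_, hmem ⟨ψ, hψ⟩, hinv ⟨ψ, hψ⟩⟩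

end

/-! ### The thimbles are the explicit arcs -/

/-- The direction `ζ^{-j}` of the path `γ_j`. -/
def direction (a b j : ℕ) : ℂ :=
  Complex.exp (-(2 * Real.pi * Complex.I * j / ((a : ℂ) + b)))

/-- The explicit parametrization of the thimble `D_j`. -/
def thimbleArc (a b j : ℕ) (ψ : ℝ) : ℂ × ℂ := direction a b j • modelArc a b ψ

section

variable {a b : ℕ}

theorem critValue_eq (j : ℕ) : critValue a b j = critRadius a b * direction a b j := rfl

theorem direction_ne_zero (j : ℕ) : direction a b j ≠ 0 := Complex.exp_ne_zero _

theorem direction_pow (ha : 0 < a) (j : ℕ) : direction a b j ^ (a + b) = 1 := by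
  rw [direction, ← Complex.exp_nat_mul, Complex.exp_eq_one_iff]
  refine ⟨-j, ?_⟩
  have : (a : ℂ) + b ≠ 0 := by exact_mod_cast (by omega : a + b ≠ 0)
  push_cast
  field_simp

theorem smul_mem_curve (ha : 0 < a) (j : ℕ) {p : ℂ × ℂ} (hp : p.1 ^ a * p.2 ^ b = 1)
    (h1 : p.1 ≠ 0) (h2 : p.2 ≠ 0) : direction a b j • p ∈ curve a b := by
  refine ⟨mul_ne_zero (direction_ne_zero j) h1, mul_ne_zero (direction_ne_zero j) h2, ?_⟩
  have := direction_pow (b := b) ha j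
  simp only [Prod.smul_fst, Prod.smul_snd, smul_eq_mul, mul_pow]
  rw [pow_add] at this
  linear_combination (p.1 ^ a * p.2 ^ b) * this + hp

theorem W_smul (c : ℂ) (p : ℂ × ℂ) : W (c • p) = c * (p.1 + p.2) := by
  simp [W, mul_add]

/-- The tangent line of `X` at `(x, y)` is spanned by `(bx, -ay)`, and `dW` takes the value `bx -
ay` on it. -/
theorem isCritical_iff (ha : 0 < a) (hb : 0 < b) (p : ℂ × ℂ) :
    IsCritical a b p ↔ p ∈ curve a b ∧ b * p.1 = a * p.2 := by
  refine and_congr_right fun hp => ?_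
  obtain ⟨h1, h2, h3⟩ := hp
  have hW : ∀ v : ℂ × ℂ, fderiv ℂ W p v = v.1 + v.2 := by
    intro v
    have : HasFDerivAt W (ContinuousLinearMap.fst ℂ ℂ ℂ + ContinuousLinearMap.snd ℂ ℂ ℂ) p :=
      hasFDerivAt_fst.add hasFDerivAt_snd
    rw [this.fderiv]
    rfl
  -- The factor `xy` restores the lowered exponents `a - 1` and `b - 1`, after which `x^a y^b = 1`
  -- applies.
  have hf : ∀ v : ℂ × ℂ, p.1 * p.2 * fderiv ℂ (fun q : ℂ × ℂ => q.1 ^ a * q.2 ^ b) p v =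
      a * v.1 * p.2 + b * v.2 * p.1 := by
    intro v
    have h : HasFDerivAt (fun q : ℂ × ℂ => q.1 ^ a * q.2 ^ b) _ p :=
      ((hasFDerivAt_fst (𝕜 := ℂ) (p := p)).pow a).mul ((hasFDerivAt_snd (𝕜 := ℂ) (p := p)).pow b)
    rw [h.fderiv]
    simp only [add_apply, smul_apply, smul_eq_mul,
      nsmul_eq_mul, ContinuousLinearMap.coe_fst', ContinuousLinearMap.coe_snd']
    obtain ⟨a, rfl⟩ := Nat.exists_eq_succ_of_ne_zero ha.ne'
    obtain ⟨b, rfl⟩ := Nat.exists_eq_succ_of_ne_zero hb.ne'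
    simp only [Nat.succ_eq_add_one, Nat.add_sub_cancel] at h3 ⊢
    push_cast
    linear_combination (((a : ℂ) + 1) * v.1 * p.2 + (b + 1) * v.2 * p.1) * h3
  constructor
  · intro h
    have h4 := h (b * p.1, -(a * p.2)) (by
      have := hf (b * p.1, -(a * p.2))
      refine (mul_eq_zero.1 (this.trans (by ring))).resolve_left (mul_ne_zero h1 h2))
    rw [hW] at h4
    linear_combination h4
  · intro h v hv
    have h4 := hf v
    rw [hv] at h4
    rw [hW]
    have ha' : (a : ℂ) ≠ 0 := by exact_mod_cast ha.ne'
    have hb' : (b : ℂ) ≠ 0 := by exact_mod_cast hb.ne'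
    have : b * p.1 * (v.1 + v.2) = 0 := by linear_combination v.1 * h - h4
    exact (mul_eq_zero.1 this).resolve_left (mul_ne_zero hb' h1)

/-- Compatible arguments `bψ` and `-aψ` determine the point. The curve equation reduces both moduli
to one real `v`. For `ψ ≠ 0`, reality of `x + y` fixes `v`; for `ψ = 0` that condition is empty and
the bound `x + y ≤ λ_0` takes its place. -/
theorem eq_modelArc (ha : 0 < a) (hb : 0 < b) {p : ℂ × ℂ} {t ψ R S : ℝ} (ht : t ≤ 1)
    (hp : p.1 ^ a * p.2 ^ b = 1) (hsum : p.1 + p.2 = (t * critRadius a b : ℝ))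
    (hψ : |ψ| ≤ endAngle a b) (hR : 0 < R) (hS : 0 < S)
    (h1 : p.1 = R * Complex.exp ((b * ψ : ℝ) * Complex.I))
    (h2 : p.2 = S * Complex.exp ((-(a * ψ) : ℝ) * Complex.I)) : p = modelArc a b ψ := by
  have ha' : (0 : ℝ) < a := by exact_mod_cast ha
  have hb' : (0 : ℝ) < b := by exact_mod_cast hb
  have hn1 : ‖p.1‖ = R := by
    rw [h1, norm_mul, Complex.norm_exp_ofReal_mul_I, mul_one, Complex.norm_of_nonneg hR.le]
  have hn2 : ‖p.2‖ = S := by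
    rw [h2, norm_mul, Complex.norm_exp_ofReal_mul_I, mul_one, Complex.norm_of_nonneg hS.le]
  have hRS : R ^ a * S ^ b = 1 := by
    rw [← hn1, ← hn2, ← norm_pow, ← norm_pow, ← norm_mul, hp, norm_one]
  have hlog : a * Real.log R + b * Real.log S = 0 := by
    have := congrArg Real.log hRS
    rwa [Real.log_mul (by positivity) (by positivity), Real.log_pow, Real.log_pow,
      Real.log_one] at this
  obtain ⟨v, hv⟩ : ∃ v, v = Real.log R / b := ⟨_, rfl⟩
  have hRv : R = Real.exp (b * v) := by
    rw [hv, mul_div_cancel₀ _ hb'.ne', Real.exp_log hR]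
  have hSv : S = Real.exp (-(a * v)) := by
    have : -(a * v) = Real.log S := by
      rw [hv]
      field_simp
      linarith
    rw [this, Real.exp_log hS]
  suffices hvl : v = logModulus a b ψ by
    refine Prod.ext ?_ ?_
    · rw [h1, hRv, hvl, modelArc_fst]
    · rw [h2, hSv, hvl, modelArc_snd]
  rcases eq_or_ne ψ 0 with rfl | hne
  -- The function `v ↦ e^{bv} + e^{-av}` is strictly convex with minimum `λ_0` at the critical
  -- point. The strict inequality `1 + s < e^s` for both exponentials contradicts `x + y ≤ λ_0`, as
  -- the linear terms cancel by `bx = ay`.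
  · by_contra hvne
    have hsum' : R + S = t * critRadius a b := by
      have := congrArg Complex.re hsum
      rw [h1, h2] at this
      simpa using this
    have hle : R + S ≤ height a b 0 := by
      rw [hsum', height_zero ha hb]
      nlinarith [critRadius_pos ha hb]
    have hd : v - logModulus a b 0 ≠ 0 := sub_ne_zero.2 hvne
    have i1 := Real.add_one_lt_exp (mul_ne_zero hb'.ne' hd)
    have i2 := Real.add_one_lt_exp (mul_ne_zero (neg_ne_zero.2 ha'.ne') hd)
    have e1 : R = Real.exp (b * logModulus a b 0) * Real.exp (b * (v - logModulus a b 0)) := by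
      rw [hRv, ← Real.exp_add]; ring_nf
    have e2 : S = Real.exp (-(a * logModulus a b 0)) * Real.exp (-a * (v - logModulus a b 0)) := by
      rw [hSv, ← Real.exp_add]; ring_nf
    have e3 := mul_exp_logModulus_zero ha hb
    have p1 := mul_lt_mul_of_pos_left i1 (Real.exp_pos (b * logModulus a b 0))
    have p2 := mul_lt_mul_of_pos_left i2 (Real.exp_pos (-(a * logModulus a b 0)))
    rw [← e1] at p1
    rw [← e2] at p2
    simp only [height, mul_zero, Real.cos_zero, mul_one] at hle
    have : (v - logModulus a b 0) * (b * Real.exp (b * logModulus a b 0)) =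
      (v - logModulus a b 0) * (a * Real.exp (-(a * logModulus a b 0))) := by rw [e3]
    linarith
  · have him : R * Real.sin (b * ψ) = S * Real.sin (a * ψ) := by
      have := congrArg Complex.im hsum
      rw [h1, h2, Complex.ofReal_im, Complex.add_im, Complex.im_ofReal_mul,
        Complex.im_ofReal_mul, Complex.exp_ofReal_mul_I_im,
        Complex.exp_ofReal_mul_I_im, Real.sin_neg] at this
      linarith
    have hpi : |ψ| < Real.pi := by
      have := left_mul_lt_pi ha hb hψ
      have : (1 : ℝ) ≤ a := by exact_mod_cast ha
      nlinarith [abs_nonneg ψ]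
    have hsin : Real.sin ψ ≠ 0 := by
      rw [abs_lt] at hpi
      exact fun h => hne ((Real.sin_eq_zero_iff_of_lt_of_lt hpi.1 hpi.2).1 h)
    rw [← sinRatio_mul_sin, ← sinRatio_mul_sin, ← mul_assoc, ← mul_assoc] at him
    have him' := mul_right_cancel₀ hsin him
    have h2 := sinRatio_pos hb (right_mul_lt_pi ha hb hψ)
    have h3 : sinRatio a ψ / sinRatio b ψ = Real.exp ((a + b) * v) := by
      have : Real.exp ((a + b) * v) = R / S := by
        rw [hRv, hSv, ← Real.exp_sub]; ring_nf
      rw [this, div_eq_div_iff h2.ne' hS.ne', him']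
      ring
    rw [logModulus, h3, Real.log_exp, mul_div_cancel_left₀ _ (by positivity)]

theorem modelArc_mem_slitPlane (ha : 0 < a) (hb : 0 < b) {ψ : ℝ} (h : |ψ| ≤ endAngle a b) :
    (modelArc a b ψ).1 ∈ Complex.slitPlane ∧ (modelArc a b ψ).2 ∈ Complex.slitPlane ∧
      (modelArc a b ψ).1.arg = b * ψ ∧ (modelArc a b ψ).2.arg = -(a * ψ) := by
  have ha' : (0 : ℝ) < a := by exact_mod_cast ha
  have hb' : (0 : ℝ) < b := by exact_mod_cast hb
  have l1 : |b * ψ| < Real.pi := by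
    rw [abs_mul, abs_of_pos hb']; exact right_mul_lt_pi ha hb h
  have l2 : |-(a * ψ)| < Real.pi := by
    rw [abs_neg, abs_mul, abs_of_pos ha']; exact left_mul_lt_pi ha hb h
  have e1 : (modelArc a b ψ).1.arg = b * ψ := by
    rw [modelArc_fst, Complex.exp_mul_I]
    exact Complex.arg_mul_cos_add_sin_mul_I (Real.exp_pos _) ⟨(abs_lt.1 l1).1, (abs_lt.1 l1).2.le⟩
  have e2 : (modelArc a b ψ).2.arg = -(a * ψ) := by
    rw [modelArc_snd, Complex.exp_mul_I]
    exact Complex.arg_mul_cos_add_sin_mul_I (Real.exp_pos _) ⟨(abs_lt.1 l2).1, (abs_lt.1 l2).2.le⟩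
  refine ⟨Complex.mem_slitPlane_iff_arg.2 ⟨?_, Complex.exp_ne_zero _⟩,
    Complex.mem_slitPlane_iff_arg.2 ⟨?_, Complex.exp_ne_zero _⟩, e1, e2⟩
  · rw [e1]; exact (abs_lt.1 l1).2.ne
  · rw [e2]; exact (abs_lt.1 l2).2.ne

/-- The openness half of path lifting. Near the arc both coordinates stay in the slit plane, so
their arguments are continuous. The sum `a·arg x + b·arg y` lies in `2πℤ` and is small, hence zero,
and `eq_modelArc` applies with `ψ = arg x / b`. This works at the critical point too, where `W` is
not a local homeomorphism. -/
theorem eventually_mem_modelArc (ha : 0 < a) (hb : 0 < b) {ψ : ℝ} (h : |ψ| < endAngle a b) :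
    ∀ᶠ p in 𝓝 (modelArc a b ψ), p.1 ^ a * p.2 ^ b = 1 → ∀ t : ℝ, t ≤ 1 →
      p.1 + p.2 = ((t * critRadius a b : ℝ) : ℂ) →
        p ∈ modelArc a b '' Icc (-endAngle a b) (endAngle a b) := by
  have ha' : (0 : ℝ) < a := by exact_mod_cast ha
  have hb' : (0 : ℝ) < b := by exact_mod_cast hb
  obtain ⟨s1, s2, e1, e2⟩ := modelArc_mem_slitPlane ha hb h.le
  have c1 : ContinuousAt (fun p : ℂ × ℂ => p.1.arg) (modelArc a b ψ) :=
    ContinuousAt.comp (f := Prod.fst) (Complex.continuousAt_arg s1) continuousAt_fst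
  have c2 : ContinuousAt (fun p : ℂ × ℂ => p.2.arg) (modelArc a b ψ) :=
    ContinuousAt.comp (f := Prod.snd) (Complex.continuousAt_arg s2) continuousAt_snd
  have c3 : ContinuousAt (fun p : ℂ × ℂ => |a * p.1.arg + b * p.2.arg|) (modelArc a b ψ) :=
    ((c1.const_mul _).add (c2.const_mul _)).abs
  have v1 := c1.abs.eventually_lt_const (show |(modelArc a b ψ).1.arg| < b * endAngle a b by
    rw [e1, abs_mul, abs_of_pos hb']; nlinarith)
  have v2 := c3.eventually_lt_const
    (show |a * (modelArc a b ψ).1.arg + b * (modelArc a b ψ).2.arg| < 2 * Real.pi by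
      rw [e1, e2, show (a : ℝ) * (b * ψ) + b * (-(a * ψ)) = 0 by ring, abs_zero]
      linarith [Real.pi_pos])
  filter_upwards [v1, v2] with p w1 w2 hp t ht hsum
  have n1 : p.1 ≠ 0 := by
    intro h0; rw [h0, zero_pow ha.ne', zero_mul] at hp; exact zero_ne_one hp
  have n2 : p.2 ≠ 0 := by
    intro h0; rw [h0, zero_pow hb.ne', mul_zero] at hp; exact zero_ne_one hp
  have f1 := Complex.norm_mul_exp_arg_mul_I p.1
  have f2 := Complex.norm_mul_exp_arg_mul_I p.2
  have hn : ‖p.1‖ ^ a * ‖p.2‖ ^ b = 1 := by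
    rw [← norm_pow, ← norm_pow, ← norm_mul, hp, norm_one]
  have hexp : Complex.exp ((a * p.1.arg + b * p.2.arg : ℝ) * Complex.I) = 1 := by
    have hn' : (‖p.1‖ : ℂ) ^ a * (‖p.2‖ : ℂ) ^ b = 1 := by exact_mod_cast hn
    rw [← f1, ← f2, mul_pow, mul_pow, ← Complex.exp_nat_mul, ← Complex.exp_nat_mul] at hp
    have : Complex.exp ((a * p.1.arg + b * p.2.arg : ℝ) * Complex.I) =
        Complex.exp (a * (p.1.arg * Complex.I)) * Complex.exp (b * (p.2.arg * Complex.I)) := by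
      rw [← Complex.exp_add]; push_cast; ring_nf
    rw [this]
    linear_combination hp - (Complex.exp (a * (p.1.arg * Complex.I)) *
      Complex.exp (b * (p.2.arg * Complex.I))) * hn'
  have hzero : a * p.1.arg + b * p.2.arg = 0 := by
    obtain ⟨n, hn⟩ := Complex.exp_eq_one_iff.1 hexp
    have hn' : a * p.1.arg + b * p.2.arg = n * (2 * Real.pi) := by
      have := congrArg Complex.im hn
      simpa using this
    rw [hn', abs_mul, abs_of_pos Real.two_pi_pos, mul_lt_iff_lt_one_left Real.two_pi_pos] at w2
    have : n = 0 := Int.abs_lt_one_iff.1 (by exact_mod_cast w2)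
    rw [hn', this]; simp
  have hψ : |p.1.arg / b| ≤ endAngle a b := by
    rw [abs_div, abs_of_pos hb', div_le_iff₀ hb', mul_comm]; exact w1.le
  refine ⟨p.1.arg / b, abs_le.1 hψ, (eq_modelArc ha hb ht hp hsum hψ (norm_pos_iff.2 n1)
    (norm_pos_iff.2 n2) ?_ ?_).symm⟩
  · rw [mul_div_cancel₀ _ hb'.ne', f1]
  · rw [show -(a * (p.1.arg / b)) = p.2.arg by field_simp; linarith, f2]

theorem modelArc_zero_crit (ha : 0 < a) (hb : 0 < b) :
    b * (modelArc a b 0).1 = a * (modelArc a b 0).2 := by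
  rw [modelArc_fst, modelArc_snd]
  have := congrArg ((↑) : ℝ → ℂ) (mul_exp_logModulus_zero ha hb)
  rw [Complex.ofReal_mul, Complex.ofReal_mul] at this
  simp only [mul_zero, Complex.ofReal_zero, zero_mul, Complex.exp_zero, neg_zero, mul_one]
  exact_mod_cast this

theorem modelArc_zero_eq (ha : 0 < a) (hb : 0 < b) {p : ℂ × ℂ} (h : b * p.1 = a * p.2)
    (hsum : p.1 + p.2 = critRadius a b) : p = modelArc a b 0 := by
  have ha' : (a : ℂ) + b ≠ 0 := by exact_mod_cast (by omega : a + b ≠ 0)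
  have h1 := modelArc_zero_crit ha hb
  have h2 := modelArc_add ha hb (ψ := 0) (by simpa using (endAngle_pos ha).le)
  rw [height_zero ha hb] at h2
  refine Prod.ext (mul_left_cancel₀ ha' ?_) (mul_left_cancel₀ ha' ?_)
  · linear_combination h - h1 + a * hsum - a * h2
  · linear_combination h1 - h + b * hsum - b * h2

theorem continuousOn_modelArc (ha : 0 < a) (hb : 0 < b) :
    ContinuousOn (modelArc a b) (Icc (-endAngle a b) (endAngle a b)) := fun _ hψ =>
  (continuousAt_modelArc ha hb (abs_le.2 hψ)).continuousWithinAt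

theorem height_abs (ψ : ℝ) : height a b |ψ| = height a b ψ := by
  rcases abs_choice ψ with h | h <;> rw [h]
  exact height_neg ψ

theorem thimble_subset (ha : 0 < a) (hb : 0 < b) (j : ℕ) :
    thimble a b j ⊆ thimbleArc a b j '' Icc (-endAngle a b) (endAngle a b) := by
  rintro p ⟨u, hu, hlift, hcrit, t₀, ht₀, rfl⟩
  have he := endAngle_pos (b := b) ha
  have hω := direction_ne_zero (a := a) (b := b) j
  -- Rotate to `D_0` and reverse time, so that the lift starts at the critical point.
  set v : ℝ → ℂ × ℂ := fun s => (direction a b j)⁻¹ • u (1 - s) with hv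
  have hvu : ∀ s, u (1 - s) = direction a b j • v s := fun s => by
    rw [hv]; exact (smul_inv_smul₀ hω _).symm
  have hflip : ∀ s ∈ Icc (0 : ℝ) 1, 1 - s ∈ Icc (0 : ℝ) 1 := fun s hs =>
    ⟨by linarith [hs.2], by linarith [hs.1]⟩
  have hvc : ContinuousOn v (Icc 0 1) :=
    ContinuousOn.const_smul (g := fun s => u (1 - s)) (hu.comp (by fun_prop) hflip)
      (direction a b j)⁻¹
  have hvlift : ∀ s ∈ Icc (0 : ℝ) 1, (v s).1 ^ a * (v s).2 ^ b = 1 ∧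
      (v s).1 + (v s).2 = ((1 - s) * critRadius a b : ℝ) := by
    intro s hs
    obtain ⟨⟨-, -, h3⟩, h4⟩ := hlift _ (hflip s hs)
    rw [hvu] at h3 h4
    rw [W_smul, critValue_eq] at h4
    simp only [Prod.smul_fst, Prod.smul_snd, smul_eq_mul, mul_pow] at h3
    have hd := direction_pow (b := b) ha j
    rw [pow_add] at hd
    constructor
    · linear_combination h3 - ((v s).1 ^ a * (v s).2 ^ b) * hd
    · apply mul_left_cancel₀ hω
      rw [h4]
      push_cast
      ring
  have hv0 : v 0 = modelArc a b 0 := by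
    have hc := ((isCritical_iff ha hb _).1 hcrit).2
    rw [show u 1 = direction a b j • v 0 by rw [← hvu, sub_zero]] at hc
    apply modelArc_zero_eq ha hb
    · apply mul_left_cancel₀ hω
      simp only [Prod.smul_fst, Prod.smul_snd, smul_eq_mul] at hc
      linear_combination hc
    · simpa using (hvlift 0 ⟨le_rfl, zero_le_one⟩).2
  have hcompact : IsCompact (modelArc a b '' Icc (-endAngle a b) (endAngle a b)) :=
    isCompact_Icc.image_of_continuousOn (continuousOn_modelArc ha hb)
  -- The set of times spent on the arc is closed, as the arc is compact. It can be prolonged to the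
  -- right because for `s < 1` the height is positive, so the point is not an end of the arc.
  have key : Icc (0 : ℝ) 1 ⊆ v ⁻¹' (modelArc a b '' Icc (-endAngle a b) (endAngle a b)) := by
    apply IsClosed.Icc_subset_of_forall_exists_gt
    · rw [inter_comm]
      exact hvc.preimage_isClosed_of_isClosed isClosed_Icc hcompact.isClosed
    · exact ⟨0, ⟨by linarith, he.le⟩, hv0.symm⟩
    · rintro s ⟨⟨ψ, hψ, hψs⟩, hs⟩ y hy
      have hs' : s ∈ Icc (0 : ℝ) 1 := ⟨hs.1, hs.2.le⟩
      have habs : |ψ| ≤ endAngle a b := abs_le.2 hψ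
      have hlt : |ψ| < endAngle a b := by
        refine lt_of_le_of_ne habs fun heq => ?_
        have h1 := (hvlift s hs').2
        rw [← hψs, modelArc_add ha hb habs, ← height_abs, heq, height_endAngle ha hb] at h1
        have h2 : (0 : ℝ) = (1 - s) * critRadius a b := by exact_mod_cast h1
        have := mul_pos (sub_pos.2 hs.2) (critRadius_pos ha hb)
        linarith
      have hev := eventually_mem_modelArc ha hb hlt
      rw [hψs] at hev
      have hev2 := (hvc s hs').eventually hev
      have hev3 : ∀ᶠ x in 𝓝[>] s, x ∈ Ioo s 1 ∧ v x ∈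
          modelArc a b '' Icc (-endAngle a b) (endAngle a b) := by
        rw [← nhdsWithin_Ioo_eq_nhdsGT hs.2]
        filter_upwards [hev2.filter_mono (nhdsWithin_mono s fun x hx =>
          (⟨hs.1.trans hx.1.le, hx.2.le⟩ : x ∈ Icc (0 : ℝ) 1)), self_mem_nhdsWithin] with x hx hx'
        have hx01 : x ∈ Icc (0 : ℝ) 1 := ⟨hs.1.trans hx'.1.le, hx'.2.le⟩
        exact ⟨hx', hx (hvlift x hx01).1 (1 - x) (by linarith [hx01.1]) (hvlift x hx01).2⟩
      obtain ⟨x, hx, hx'⟩ := (hev3.and (Ioc_mem_nhdsGT hy)).exists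
      exact ⟨x, hx.2, hx'⟩
  obtain ⟨ψ, hψ, h⟩ := key (hflip t₀ ht₀)
  refine ⟨ψ, hψ, ?_⟩
  rw [thimbleArc, h, ← hvu, sub_sub_cancel]

theorem subset_thimble (ha : 0 < a) (hb : 0 < b) (j : ℕ) :
    thimbleArc a b j '' Icc (-endAngle a b) (endAngle a b) ⊆ thimble a b j := by
  rintro _ ⟨ψ, hψ, rfl⟩
  obtain ⟨θ, hθc, hθ, hθ1, hsurj⟩ := exists_angle_of_height ha hb
  -- Each half of the arc, selected by the sign `σ`, is one lift of `γ_j`, parametrized by height.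
  obtain ⟨σ, hσ, hψσ⟩ : ∃ σ : ℝ, (σ = 1 ∨ σ = -1) ∧ ψ = σ * |ψ| := by
    rcases abs_choice ψ with h | h
    · exact ⟨1, Or.inl rfl, by rw [h]; ring⟩
    · exact ⟨-1, Or.inr rfl, by rw [h]; ring⟩
  have habs : ∀ x : ℝ, |σ * x| = |x| := by
    rcases hσ with rfl | rfl <;> intro x <;> simp
  have hht : ∀ x : ℝ, height a b (σ * x) = height a b x := by
    intro x; rw [← height_abs, habs, height_abs]
  have hmem : ∀ t ∈ Icc (0 : ℝ) 1, |σ * θ t| ≤ endAngle a b := by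
    intro t ht
    rw [habs, abs_of_nonneg (hθ t ht).1.1]
    exact (hθ t ht).1.2
  obtain ⟨t, ht, htψ⟩ := hsurj |ψ| ⟨abs_nonneg _, abs_le.2 hψ⟩
  have hcurve : ∀ x, thimbleArc a b j x ∈ curve a b := fun x =>
    smul_mem_curve ha j (modelArc_mul x) (Complex.exp_ne_zero _) (Complex.exp_ne_zero _)
  refine ⟨fun t => thimbleArc a b j (σ * θ t), ?_, fun t ht => ⟨hcurve _, ?_⟩, ?_, t, ht, ?_⟩
  · exact ContinuousOn.const_smul (g := fun t => modelArc a b (σ * θ t))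
      ((continuousOn_modelArc ha hb).comp (hθc.const_mul σ) fun t ht => abs_le.1 (hmem t ht))
      (direction a b j)
  · dsimp only
    rw [thimbleArc, W_smul, modelArc_add ha hb (hmem t ht), hht, (hθ t ht).2, critValue_eq]
    push_cast
    ring
  · rw [isCritical_iff ha hb]
    refine ⟨hcurve _, ?_⟩
    dsimp only
    rw [hθ1, mul_zero, thimbleArc, Prod.smul_fst, Prod.smul_snd, smul_eq_mul, smul_eq_mul]
    linear_combination direction a b j * modelArc_zero_crit ha hb
  · simp only [htψ, ← hψσ]

theorem thimble_eq (ha : 0 < a) (hb : 0 < b) (j : ℕ) :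
    thimble a b j = thimbleArc a b j '' Icc (-endAngle a b) (endAngle a b) :=
  (thimble_subset ha hb j).antisymm (subset_thimble ha hb j)

/-! ### Vanishing cycles -/

/-- The points of the reference fiber. -/
def fiberPoint (a b : ℕ) (m : ℤ) : ℂ × ℂ :=
  (Complex.exp (endAngle a b * m * Complex.I), -Complex.exp (endAngle a b * m * Complex.I))

theorem fiberPoint_eq_iff (ha : 0 < a) (m n : ℤ) :
    fiberPoint a b m = fiberPoint a b n ↔ (2 * (a + b) : ℤ) ∣ m - n := by
  have he := add_mul_endAngle (b := b) ha
  have he0 : (endAngle a b : ℂ) ≠ 0 := by exact_mod_cast (endAngle_pos ha).ne'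
  have heC : ((a : ℂ) + b) * endAngle a b = Real.pi := by exact_mod_cast he
  have h1 : fiberPoint a b m = fiberPoint a b n ↔
      Complex.exp (endAngle a b * m * Complex.I) = Complex.exp (endAngle a b * n * Complex.I) := by
    simp [fiberPoint]
  rw [h1, Complex.exp_eq_exp_iff_exists_int]
  refine exists_congr fun k => ?_
  rw [← heC]
  constructor
  · intro h
    have h2 : (endAngle a b * Complex.I) * (m - n : ℂ) =
        (endAngle a b * Complex.I) * (2 * (a + b) * k) := by linear_combination h
    have h3 := mul_left_cancel₀ (mul_ne_zero he0 Complex.I_ne_zero) h2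
    exact_mod_cast h3
  · intro h
    have h3 : (m : ℂ) - n = 2 * (a + b) * k := by exact_mod_cast h
    linear_combination endAngle a b * Complex.I * h3

theorem direction_eq (ha : 0 < a) (j : ℕ) :
    direction a b j = Complex.exp (endAngle a b * (-2 * j) * Complex.I) := by
  have : (a : ℂ) + b ≠ 0 := by exact_mod_cast (by omega : a + b ≠ 0)
  rw [direction, endAngle]
  push_cast
  congr 1
  field_simp

theorem thimbleArc_endAngle (ha : 0 < a) (hb : 0 < b) (j : ℕ) :
    thimbleArc a b j (endAngle a b) = fiberPoint a b (-2 * j + b) := by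
  have heC : ((a : ℂ) + b) * endAngle a b = Real.pi := by
    exact_mod_cast add_mul_endAngle (b := b) ha
  refine Prod.ext ?_ ?_
  · rw [thimbleArc, Prod.smul_fst, smul_eq_mul, modelArc_fst, logModulus_endAngle ha hb,
      direction_eq ha, fiberPoint]
    simp only [mul_zero, Real.exp_zero, Complex.ofReal_one, one_mul, ← Complex.exp_add]
    push_cast
    ring_nf
  · rw [thimbleArc, Prod.smul_snd, smul_eq_mul, modelArc_snd, logModulus_endAngle ha hb,
      direction_eq ha, fiberPoint]
    simp only [mul_zero, neg_zero, Real.exp_zero, Complex.ofReal_one, one_mul, ← Complex.exp_add]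
    -- Here `-1 = e^{-i(a+b)π/(a+b)}` turns the exponent `b` into `-a`, the argument of `y` at this
    -- end; at the other end `-1 = e^{iπ}` turns `-b` into `a`.
    rw [← neg_one_mul (Complex.exp _), ← Complex.exp_neg_pi_mul_I, ← Complex.exp_add, ← heC]
    push_cast
    ring_nf

theorem thimbleArc_neg_endAngle (ha : 0 < a) (hb : 0 < b) (j : ℕ) :
    thimbleArc a b j (-endAngle a b) = fiberPoint a b (-2 * j - b) := by
  have heC : ((a : ℂ) + b) * endAngle a b = Real.pi := by
    exact_mod_cast add_mul_endAngle (b := b) ha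
  refine Prod.ext ?_ ?_
  · rw [thimbleArc, Prod.smul_fst, smul_eq_mul, modelArc_fst, logModulus_neg,
      logModulus_endAngle ha hb, direction_eq ha, fiberPoint]
    simp only [mul_zero, Real.exp_zero, Complex.ofReal_one, one_mul, ← Complex.exp_add]
    push_cast
    ring_nf
  · rw [thimbleArc, Prod.smul_snd, smul_eq_mul, modelArc_snd, logModulus_neg,
      logModulus_endAngle ha hb, direction_eq ha, fiberPoint]
    simp only [mul_zero, neg_zero, Real.exp_zero, Complex.ofReal_one, one_mul, ← Complex.exp_add]
    rw [← neg_one_mul (Complex.exp _), ← Complex.exp_pi_mul_I, ← Complex.exp_add, ← heC]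
    push_cast
    ring_nf

theorem thimbleArc_mem_curve (ha : 0 < a) (j : ℕ) (ψ : ℝ) : thimbleArc a b j ψ ∈ curve a b :=
  smul_mem_curve ha j (modelArc_mul ψ) (Complex.exp_ne_zero _) (Complex.exp_ne_zero _)

/-- Strict monotonicity lets the height vanish only at `ψ = ±π/(a+b)`. -/
theorem vanishingCycle_eq (ha : 0 < a) (hb : 0 < b) (j : ℕ) :
    vanishingCycle a b j = {fiberPoint a b (-2 * j + b), fiberPoint a b (-2 * j - b)} := by
  have he := endAngle_pos (b := b) ha
  rw [vanishingCycle, thimble_eq ha hb, ← thimbleArc_endAngle ha hb, ← thimbleArc_neg_endAngle ha hb]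
  have hW : ∀ ψ, |ψ| ≤ endAngle a b → W (thimbleArc a b j ψ) = direction a b j * height a b ψ :=
    fun ψ h => by rw [thimbleArc, W_smul, modelArc_add ha hb h]
  ext p
  constructor
  · rintro ⟨⟨ψ, hψ, rfl⟩, -, h⟩
    have habs := abs_le.2 hψ
    rw [hW ψ habs, ← height_abs] at h
    have h0 := (mul_eq_zero.1 h).resolve_left (direction_ne_zero j)
    have h1 : height a b |ψ| = height a b (endAngle a b) := by
      rw [height_endAngle ha hb]; exact_mod_cast h0
    have h2 := (strictAntiOn_height ha hb).injOn ⟨abs_nonneg ψ, habs⟩ ⟨he.le, le_rfl⟩ h1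
    rcases abs_choice ψ with h | h
    · left; rw [← h2, h]
    · right; rw [← h2, h, neg_neg]; rfl
  · rintro (rfl | rfl)
    · refine ⟨⟨_, ⟨by linarith, le_rfl⟩, rfl⟩, thimbleArc_mem_curve ha j _, ?_⟩
      rw [hW _ (abs_of_pos he).le, height_endAngle ha hb]; simp
    · refine ⟨⟨_, ⟨le_rfl, by linarith⟩, rfl⟩, thimbleArc_mem_curve ha j _, ?_⟩
      rw [hW _ (by rw [abs_neg, abs_of_pos he]), height_neg, height_endAngle ha hb]; simp

end

/-! ### Gradings and intersection points -/

/-- The grading of `L_j` with the phase of `D_j` lifted to `(0, π)` and the argument `-2πj/(a+b)`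
of `λ_j`. -/
def cycleGrading (a b j : ℕ) (p : ℂ × ℂ) : ℝ :=
  open Classical in
  if p = fiberPoint a b (-2 * j + b) then (a + 2 * j) * endAngle a b else
    (b + 2 * j) * endAngle a b

section

variable {a b : ℕ}

/-- Implicit differentiation of `e^{(a+b)v} sin bψ = sin aψ` at the end, where `v = 0`. It gives `v'
= cot(aπ/(a+b))`, so `v' + i` is a positive multiple of `e^{iaπ/(a+b)}`. -/
theorem deriv_logModulus_endAngle (ha : 0 < a) (hb : 0 < b) :
    deriv (logModulus a b) (endAngle a b) * Real.sin (a * endAngle a b) =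
      Real.cos (a * endAngle a b) := by
  have he := endAngle_pos (b := b) ha
  have hs := add_mul_endAngle (b := b) ha
  have habs : |endAngle a b| ≤ endAngle a b := (abs_of_pos he).le
  have h0 := ((contDiffAt_logModulus ha hb habs).differentiableAt one_ne_zero).hasDerivAt
  have h1 := (h0.const_mul ((a : ℝ) + b)).exp.mul ((hasDerivAt_id (endAngle a b)).const_mul (b : ℝ)).sin
  have h2 := ((hasDerivAt_id (endAngle a b)).const_mul (a : ℝ)).sin
  have hmem : endAngle a b ∈ Icc (-endAngle a b) (endAngle a b) := ⟨by linarith, le_rfl⟩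
  -- The identity is known only on the closed interval, so the two derivatives are compared
  -- one-sidedly at its end.
  have h3 := (h1.hasDerivWithinAt (s := Icc (-endAngle a b) (endAngle a b))).congr
    (f₁ := fun x => Real.sin (a * x))
    (fun x hx => (exp_logModulus_mul_sin ha hb (abs_le.2 hx)).symm)
    (exp_logModulus_mul_sin ha hb habs).symm
  have h4 := (uniqueDiffOn_Icc (by linarith : -endAngle a b < endAngle a b) _ hmem).eq_deriv _ h3
    h2.hasDerivWithinAt
  have e1 : (b : ℝ) * endAngle a b = Real.pi - a * endAngle a b := by linarith
  simp only [id_eq, logModulus_endAngle ha hb, mul_zero, Real.exp_zero, e1, Real.sin_pi_sub,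
    Real.cos_pi_sub, mul_one, one_mul] at h4
  have : (0 : ℝ) < a + b := by exact_mod_cast (by omega : 0 < a + b)
  apply mul_left_cancel₀ this.ne'
  linarith

theorem deriv_logModulus_neg (ψ : ℝ) :
    deriv (logModulus a b) (-ψ) = -deriv (logModulus a b) ψ := by
  have h : (fun x => logModulus a b (-x)) = logModulus a b := funext logModulus_neg
  have h2 := deriv_comp_neg (logModulus a b) ψ
  rw [h] at h2
  rw [h2, neg_neg]

theorem sin_mul_endAngle_pos (ha : 0 < a) (hb : 0 < b) : 0 < Real.sin (a * endAngle a b) := by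
  have he := endAngle_pos (b := b) ha
  have ha' : (0 : ℝ) < a := by exact_mod_cast ha
  have := left_mul_lt_pi ha hb (abs_of_pos he).le
  rw [abs_of_pos he] at this
  exact Real.sin_pos_of_pos_of_lt_pi (by positivity) this

theorem arg_endAngle (ha : 0 < a) (hb : 0 < b) :
    Complex.arg (((deriv (logModulus a b) (endAngle a b) : ℝ) : ℂ) + Complex.I) =
      a * endAngle a b := by
  have he := endAngle_pos (b := b) ha
  have ha' : (0 : ℝ) < a := by exact_mod_cast ha
  have hsin := sin_mul_endAngle_pos ha hb
  have hlt := left_mul_lt_pi ha hb (abs_of_pos he).le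
  rw [abs_of_pos he] at hlt
  have h := congrArg ((↑) : ℝ → ℂ) (deriv_logModulus_endAngle ha hb)
  rw [Complex.ofReal_mul] at h
  have key : ((Real.sin (a * endAngle a b) : ℝ) : ℂ) *
      (((deriv (logModulus a b) (endAngle a b) : ℝ) : ℂ) + Complex.I) =
      ((1 : ℝ) : ℂ) * (Complex.cos ((a * endAngle a b : ℝ) : ℂ) +
        Complex.sin ((a * endAngle a b : ℝ) : ℂ) * Complex.I) := by
    rw [← Complex.ofReal_cos, ← Complex.ofReal_sin, Complex.ofReal_one]
    linear_combination h
  rw [← Complex.arg_real_mul _ hsin, key, Complex.arg_mul_cos_add_sin_mul_I one_pos]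
  exact ⟨by have := mul_pos ha' he; linarith [Real.pi_pos], hlt.le⟩

theorem arg_neg_endAngle (ha : 0 < a) (hb : 0 < b) :
    Complex.arg (((deriv (logModulus a b) (-endAngle a b) : ℝ) : ℂ) + Complex.I) =
      b * endAngle a b := by
  have he := endAngle_pos (b := b) ha
  have hs := add_mul_endAngle (b := b) ha
  have ha' : (0 : ℝ) < a := by exact_mod_cast ha
  have hb' : (0 : ℝ) < b := by exact_mod_cast hb
  have hsin := sin_mul_endAngle_pos ha hb
  have hlt := right_mul_lt_pi ha hb (abs_of_pos he).le
  rw [abs_of_pos he] at hlt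
  have h := congrArg ((↑) : ℝ → ℂ) (deriv_logModulus_endAngle ha hb)
  rw [Complex.ofReal_mul] at h
  have e1 : (b : ℝ) * endAngle a b = Real.pi - a * endAngle a b := by linarith
  have key : ((Real.sin (a * endAngle a b) : ℝ) : ℂ) *
      (((deriv (logModulus a b) (-endAngle a b) : ℝ) : ℂ) + Complex.I) =
      ((1 : ℝ) : ℂ) * (Complex.cos ((b * endAngle a b : ℝ) : ℂ) +
        Complex.sin ((b * endAngle a b : ℝ) : ℂ) * Complex.I) := by
    rw [← Complex.ofReal_cos, ← Complex.ofReal_sin, Complex.ofReal_one, e1, Real.sin_pi_sub,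
      Real.cos_pi_sub, deriv_logModulus_neg, Complex.ofReal_neg, Complex.ofReal_neg]
    linear_combination -h
  rw [← Complex.arg_real_mul _ hsin, key, Complex.arg_mul_cos_add_sin_mul_I one_pos]
  exact ⟨by have := mul_pos hb' he; linarith [Real.pi_pos], hlt.le⟩

/-- All index differences between ends of cycles are even. Within the available range, divisibility
by `2(a+b)` leaves three values, which makes every later comparison linear arithmetic. -/
theorem fiberPoint_eq_cases (ha : 0 < a) {m n x : ℤ} (h : fiberPoint a b m = fiberPoint a b n)
    (hx : m - n = 2 * x) (h1 : -(2 * (a + b)) < x) (h2 : x < 2 * (a + b)) :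
    x = 0 ∨ x = a + b ∨ x = -(a + b) := by
  obtain ⟨k, hk⟩ := (fiberPoint_eq_iff ha m n).1 h
  have hN : (0 : ℤ) < a + b := by omega
  have hk' : x = (a + b) * k := by linarith
  have k1 : -2 < k := by by_contra hc; push Not at hc; nlinarith
  have k2 : k < 2 := by by_contra hc; push Not at hc; nlinarith
  obtain rfl | rfl | rfl : k = 0 ∨ k = 1 ∨ k = -1 := by omega
  · left; linarith
  · right; left; linarith
  · right; right; linarith

theorem fiberPoint_neg_ne (ha : 0 < a) (hb : 0 < b) (j : ℕ) :
    fiberPoint a b (-2 * j - b) ≠ fiberPoint a b (-2 * j + b) := fun h => by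
  rcases fiberPoint_eq_cases ha h (x := -b) (by ring) (by omega) (by omega) with h | h | h <;> omega

theorem isGrading_cycleGrading (ha : 0 < a) (hb : 0 < b) (j : ℕ) :
    IsGrading a b j (cycleGrading a b j) := by
  classical
  have he := endAngle_pos (b := b) ha
  have hω := direction_ne_zero (a := a) (b := b) j
  have hmem : ∀ s ∈ Icc (-1 : ℝ) 1, |s * endAngle a b| ≤ endAngle a b := by
    intro s hs
    rw [abs_mul, abs_of_pos he]
    exact mul_le_of_le_one_left he.le (abs_le.2 hs)
  set c : ℝ → ℂ × ℂ := fun s => thimbleArc a b j (s * endAngle a b) with hc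
  -- This is `dz/dψ`. Since `x = e^{bz}`, the form `dx/(bx)` is `dz`, and rotation by `ζ^{-j}` does
  -- not change it. The imaginary part is `1`, so the principal argument is a continuous phase.
  let h' : ℝ → ℂ := fun ψ => ((deriv (logModulus a b) ψ : ℝ) : ℂ) + Complex.I
  have hcd : ∀ s ∈ Icc (-1 : ℝ) 1, ContDiffAt ℝ 1 c s := by
    intro s hs
    exact ((contDiffAt_modelArc ha hb (hmem s hs)).comp s
      (contDiffAt_id.mul contDiffAt_const)).const_smul (direction a b j)
  have hud := uniqueDiffOn_Icc (by norm_num : (-1 : ℝ) < 1)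
  have hfst : ∀ s ∈ Icc (-1 : ℝ) 1, (derivWithin c (Icc (-1) 1) s).1 =
      (c s).1 * (b * (endAngle a b * h' (s * endAngle a b))) := by
    intro s hs
    have d1 := ((hcd s hs).differentiableAt one_ne_zero).hasDerivAt
    rw [d1.hasDerivWithinAt.derivWithin (hud s hs)]
    have d2 : HasDerivAt (fun x => (c x).1) (deriv c s).1 s :=
      (ContinuousLinearMap.fst ℝ ℂ ℂ).hasFDerivAt.comp_hasDerivAt s d1
    have d3 : HasDerivAt (fun x => (c x).1) _ s :=
      (HasDerivAt.scomp (h := fun x => id x * endAngle a b) s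
        (hasDerivAt_modelArc_fst ha hb (hmem s hs))
        ((hasDerivAt_id s).mul_const (endAngle a b))).const_mul (direction a b j)
    rw [d2.unique d3]
    simp only [c, h', thimbleArc, Prod.smul_fst, smul_eq_mul, id_eq, one_mul, Complex.real_smul]
    ring
  have hb' : (b : ℂ) ≠ 0 := by exact_mod_cast hb.ne'
  have hc1 : ∀ s, (c s).1 ≠ 0 := fun s => mul_ne_zero hω (Complex.exp_ne_zero _)
  have hvol : ∀ s ∈ Icc (-1 : ℝ) 1, volForm b (c s) (derivWithin c (Icc (-1) 1) s) =
      endAngle a b * h' (s * endAngle a b) := by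
    intro s hs
    rw [volForm, hfst s hs]
    field_simp [hc1 s]
  have hslit : ∀ ψ, h' ψ ∈ Complex.slitPlane := fun ψ =>
    Complex.mem_slitPlane_iff.2 (Or.inr (by simp [h']))
  refine ⟨c, fun s => (h' (s * endAngle a b)).arg, -(2 * j) * endAngle a b,
    fun s hs => (hcd s hs).contDiffWithinAt, ?_, ?_, ?_, ?_, ?_, ?_, ?_, ?_⟩
  · intro s hs h0
    have h1 := hfst s hs
    rw [h0] at h1
    have h2 : h' (s * endAngle a b) ≠ 0 := Complex.slitPlane_ne_zero (hslit _)
    have h3 : (endAngle a b : ℂ) ≠ 0 := by exact_mod_cast he.ne'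
    exact mul_ne_zero (hc1 s) (mul_ne_zero hb' (mul_ne_zero h3 h2)) h1.symm
  · intro s hs t ht hst
    have h1 := smul_right_injective _ hω hst
    have h2 := (modelArc_mem_slitPlane ha hb (hmem s hs)).2.2.1
    have h3 := (modelArc_mem_slitPlane ha hb (hmem t ht)).2.2.1
    have hbR : (b : ℝ) ≠ 0 := by exact_mod_cast hb.ne'
    rw [h1, h3] at h2
    exact (mul_right_cancel₀ he.ne' (mul_left_cancel₀ hbR h2)).symm
  · rw [thimble_eq ha hb]
    ext p
    constructor
    · rintro ⟨s, hs, rfl⟩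
      exact ⟨_, abs_le.1 (hmem s hs), rfl⟩
    · rintro ⟨ψ, hψ, rfl⟩
      refine ⟨ψ / endAngle a b, ⟨?_, ?_⟩, ?_⟩
      · rw [le_div_iff₀ he]; linarith [hψ.1]
      · rw [div_le_iff₀ he]; linarith [hψ.2]
      · simp only [c, div_mul_cancel₀ _ he.ne']
  · intro s hs
    apply ContinuousAt.continuousWithinAt
    have h1 : ContinuousAt (deriv (logModulus a b)) (s * endAngle a b) :=
      ((contDiffAt_logModulus ha hb (hmem s hs)).continuousAt_fderiv one_ne_zero).clm_apply
        (continuousAt_const (y := (1 : ℝ)))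
    have h2 : ContinuousAt h' (s * endAngle a b) :=
      (Complex.continuous_ofReal.continuousAt.comp h1).add continuousAt_const
    exact ContinuousAt.comp (f := fun s => h' (s * endAngle a b))
      (Complex.continuousAt_arg (hslit _))
      (ContinuousAt.comp (f := fun s => s * endAngle a b) h2 (by fun_prop))
  · intro s hs
    rw [hvol s hs, norm_mul, Complex.norm_of_nonneg he.le, Complex.ofReal_mul, mul_assoc,
      Complex.norm_mul_exp_arg_mul_I]
  · have h1 : direction a b j =
        Complex.exp (((-(2 * j) * endAngle a b : ℝ) : ℂ) * Complex.I) := by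
      rw [direction_eq ha]; push_cast; ring_nf
    rw [critValue_eq, norm_mul, h1, Complex.norm_exp_ofReal_mul_I, mul_one,
      Complex.norm_of_nonneg (critRadius_pos ha hb).le]
  · have h1 : c (-1) = fiberPoint a b (-2 * j - b) := by
      rw [← thimbleArc_neg_endAngle ha hb, hc]; simp
    rw [cycleGrading, h1, if_neg (fiberPoint_neg_ne ha hb j)]
    simp only [h', neg_one_mul, arg_neg_endAngle ha hb]
    ring
  · have h1 : c 1 = fiberPoint a b (-2 * j + b) := by
      rw [← thimbleArc_endAngle ha hb, hc]; simp
    rw [cycleGrading, h1, if_pos rfl]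
    simp only [h', one_mul, arg_endAngle ha hb]
    ring

/-! ### Intersection points and their degrees. -/

theorem cycleGrading_pos (j : ℕ) :
    cycleGrading a b j (fiberPoint a b (-2 * j + b)) = (a + 2 * j) * endAngle a b := if_pos rfl

theorem cycleGrading_neg (ha : 0 < a) (hb : 0 < b) (j : ℕ) :
    cycleGrading a b j (fiberPoint a b (-2 * j - b)) = (b + 2 * j) * endAngle a b :=
  if_neg (fiberPoint_neg_ne ha hb j)

/-- The two ends of `L_i` lie on `L_{i+a}` and `L_{i+b}`, and there are no other intersections. -/
theorem mem_inter_iff (ha : 0 < a) (hb : 0 < b) {i j : ℕ} (hij : i < j) (hj : j < a + b)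
    (p : ℂ × ℂ) : p ∈ vanishingCycle a b i ∧ p ∈ vanishingCycle a b j ↔
      (i + a = j ∧ p = fiberPoint a b (-2 * i + b)) ∨
        (i + b = j ∧ p = fiberPoint a b (-2 * i - b)) := by
  rw [vanishingCycle_eq ha hb, vanishingCycle_eq ha hb]
  constructor
  · rintro ⟨rfl | rfl, h | h⟩
    · rcases fiberPoint_eq_cases ha h (x := j - i) (by ring) (by omega) (by omega) with h | h | h <;>
        omega
    · rcases fiberPoint_eq_cases ha h (x := j - i + b) (by ring) (by omega) (by omega)
        with h | h | h
      · omega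
      · exact Or.inl ⟨by omega, rfl⟩
      · omega
    · rcases fiberPoint_eq_cases ha h (x := j - i - b) (by ring) (by omega) (by omega)
        with h | h | h
      · exact Or.inr ⟨by omega, rfl⟩
      · omega
      · omega
    · rcases fiberPoint_eq_cases ha h (x := j - i) (by ring) (by omega) (by omega) with h | h | h <;>
        omega
  · rintro (⟨rfl, rfl⟩ | ⟨rfl, rfl⟩)
    · refine ⟨Or.inl rfl, Or.inr ((fiberPoint_eq_iff ha _ _).2 ⟨1, ?_⟩)⟩
      push_cast; ring
    · refine ⟨Or.inr rfl, Or.inl ((fiberPoint_eq_iff ha _ _).2 ⟨0, ?_⟩)⟩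
      push_cast; ring

/-- The plus end of `L_i` is the minus end of `L_{i+a}`, so in units of `π/(a+b)` the difference is
`(b + 2i + 2a) - (a + 2i) = a + b`. -/
theorem cycleGrading_sub_left (ha : 0 < a) (hb : 0 < b) (i : ℕ) :
    cycleGrading a b (i + a) (fiberPoint a b (-2 * i + b)) -
      cycleGrading a b i (fiberPoint a b (-2 * i + b)) = Real.pi := by
  have h : fiberPoint a b (-2 * i + b) = fiberPoint a b (-2 * (i + a : ℕ) - b) :=
    (fiberPoint_eq_iff ha _ _).2 ⟨1, by push_cast; ring⟩
  rw [cycleGrading_pos, h, cycleGrading_neg ha hb, ← add_mul_endAngle (b := b) ha]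
  push_cast
  ring

theorem cycleGrading_sub_right (ha : 0 < a) (hb : 0 < b) (i : ℕ) :
    cycleGrading a b (i + b) (fiberPoint a b (-2 * i - b)) -
      cycleGrading a b i (fiberPoint a b (-2 * i - b)) = Real.pi := by
  have h : fiberPoint a b (-2 * i - b) = fiberPoint a b (-2 * (i + b : ℕ) + b) :=
    (fiberPoint_eq_iff ha _ _).2 ⟨0, by push_cast; ring⟩
  rw [cycleGrading_neg ha hb, h, cycleGrading_pos, ← add_mul_endAngle (b := b) ha]
  push_cast
  ring

theorem cycleGrading_sub (ha : 0 < a) (hb : 0 < b) {i j : ℕ} (hij : i < j) (hj : j < a + b)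
    {p : ℂ × ℂ} (hi : p ∈ vanishingCycle a b i) (hj' : p ∈ vanishingCycle a b j) :
    cycleGrading a b j p - cycleGrading a b i p = Real.pi := by
  rcases (mem_inter_iff ha hb hij hj p).1 ⟨hi, hj'⟩ with ⟨rfl, rfl⟩ | ⟨rfl, rfl⟩
  · exact cycleGrading_sub_left ha hb i
  · exact cycleGrading_sub_right ha hb i

/-- Each end of the lowest cycle determines the index of the only higher cycle through it. -/
theorem not_mem_three_cycles (ha : 0 < a) (hb : 0 < b) {i j k : ℕ} (hij : i < j) (hjk : j < k)
    (hk : k < a + b) {p : ℂ × ℂ} (h1 : p ∈ vanishingCycle a b i) (h2 : p ∈ vanishingCycle a b j)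
    (h3 : p ∈ vanishingCycle a b k) : False := by
  have e1 := (mem_inter_iff ha hb hij (hjk.trans hk) p).1 ⟨h1, h2⟩
  have e2 := (mem_inter_iff ha hb (hij.trans hjk) hk p).1 ⟨h1, h3⟩
  have hne := fiberPoint_neg_ne ha hb i
  rcases e1 with ⟨e, rfl⟩ | ⟨e, rfl⟩ <;> rcases e2 with ⟨e', h⟩ | ⟨e', h⟩
  · omega
  · exact hne h.symm
  · exact hne h
  · omega

theorem injective_intersections (ha : 0 < a) (hb : 0 < b) :
    Function.Injective (Sum.elim (fun s : Fin b => fiberPoint a b (-2 * (s : ℕ) + b))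
      (fun s : Fin a => fiberPoint a b (-2 * (s : ℕ) - b))) := by
  rintro (s | s) (t | t) h <;> simp only [Sum.elim_inl, Sum.elim_inr] at h
  · rcases fiberPoint_eq_cases ha h (x := (t : ℕ) - (s : ℕ)) (by ring) (by omega) (by omega)
      with h | h | h
    · congr 1; ext; omega
    · omega
    · omega
  · rcases fiberPoint_eq_cases ha h (x := (t : ℕ) - (s : ℕ) + b) (by ring) (by omega) (by omega)
      with h | h | h <;> omega
  · rcases fiberPoint_eq_cases ha h (x := (t : ℕ) - (s : ℕ) - b) (by ring) (by omega) (by omega)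
      with h | h | h <;> omega
  · rcases fiberPoint_eq_cases ha h (x := (t : ℕ) - (s : ℕ)) (by ring) (by omega) (by omega)
      with h | h | h
    · congr 1; ext; omega
    · omega
    · omega

end

/-! ### Discs and the operations of `Lag_vc` -/

/-- On the fiber `y = -x`, so `x` is a root of `(-1)^b x^{a+b} - 1`. -/
theorem refFiber_finite {a b : ℕ} (ha : 0 < a) : (refFiber a b).Finite := by
  have h0 : Polynomial.C ((-1 : ℂ) ^ b) * Polynomial.X ^ (a + b) - Polynomial.C 1 ≠ 0 := by
    intro h
    have h1 := congrArg (Polynomial.eval 0) h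
    have h2 : a + b ≠ 0 := by omega
    simp only [Polynomial.eval_sub, Polynomial.eval_mul, Polynomial.eval_C, Polynomial.eval_pow,
      Polynomial.eval_X, zero_pow h2, Polynomial.eval_zero] at h1
    norm_num at h1
  refine ((Polynomial.finite_setOfPred_isRoot h0).image fun x => (x, -x)).subset ?_
  rintro ⟨x, y⟩ ⟨⟨-, -, h⟩, hW⟩
  obtain rfl : y = -x := by
    simp only [W] at hW
    linear_combination hW
  refine ⟨x, ?_, rfl⟩
  simp only at h
  rw [neg_pow] at h
  simp only [mem_ofPred_eq, Polynomial.IsRoot.def, Polynomial.eval_sub, Polynomial.eval_mul,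
    Polynomial.eval_C, Polynomial.eval_pow, Polynomial.eval_X]
  linear_combination h

theorem circ_mem (t : ℝ) : circ t ∈ closedBall (0 : ℂ) 1 := by
  rw [mem_closedBall_zero_iff, circ, Complex.norm_exp_ofReal_mul_I]

section

variable {a b : ℕ}

/-- Discs in the finite set `Σ_0` are constant. -/
theorem Disc.exists_eq_const (ha : 0 < a) {n : ℕ} {I : Fin (n + 1) → Fin (a + b)}
    {o : Fin n → Option (ℂ × ℂ)} {q : Option (ℂ × ℂ)} (D : Disc a b I o q) :
    ∃ p, q = some p ∧ (∀ s, o s = some p) ∧ ∀ s, p ∈ vanishingCycle a b (I s) := by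
  have hcont : ContinuousOn D.u (closedBall 0 1) := by
    rw [← closure_ball (0 : ℂ) one_ne_zero]
    exact D.holomorphic.continuousOn
  have hsub : (D.u '' closedBall 0 1).Subsingleton :=
    (refFiber_finite ha).countable.isTotallyDisconnected _
      (by rintro _ ⟨z, hz, rfl⟩; exact D.mem_fiber z hz)
      ((convex_closedBall (0 : ℂ) 1).isPreconnected.image _ hcont)
  have hc : ∀ x, D.u (circ x) = D.u (circ (D.t 0)) := fun x =>
    hsub ⟨_, circ_mem x, rfl⟩ ⟨_, circ_mem _, rfl⟩
  refine ⟨D.u (circ (D.t 0)), D.corner_zero, fun s => by rw [D.corner, hc], fun s => ?_⟩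
  induction s using Fin.lastCases with
  | last => rw [← hc]; exact D.arc_last _ ⟨le_rfl, D.lt_two_pi.le⟩
  | cast s =>
    rw [← hc]
    exact D.arc s _ ⟨le_rfl, (D.strictMono (Fin.castSucc_lt_succ)).le⟩

variable {k : Type*} [Field k] {φ : Fin (a + b) → ℂ × ℂ → ℝ}
  (ω : ℂ × ℂ → (ℂ × ℂ) [⋀^Fin 2]→L[ℝ] ℝ) (τ : Multiplicative ℝ →* kˣ) (ε : Signs a b)

theorem coeff_eq_zero_of_strictMono {n : ℕ} {I : Fin (n + 1) → Fin (a + b)}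
    {o : Fin n → Option (ℂ × ℂ)} {q : Option (ℂ × ℂ)} (hI : StrictMono I)
    (h : Disc a b I o q → False) : coeff a b ω τ ε I o q = 0 := by
  have : IsEmpty (Moduli a b I o q) := ⟨fun D => Quot.ind (β := fun _ => False) h D⟩
  rw [coeff, if_pos hI, finsum_of_isEmpty]

/-- A point lies on at most two vanishing cycles, so that there are no discs with three or more
boundary arcs. -/
theorem coeff_eq_zero_of_two_le (ha : 0 < a) (hb : 0 < b) {n : ℕ} (hn : 2 ≤ n)
    {I : Fin (n + 1) → Fin (a + b)} {o : Fin n → Option (ℂ × ℂ)} {q : Option (ℂ × ℂ)}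
    (hI : StrictMono I) : coeff a b ω τ ε I o q = 0 := by
  refine coeff_eq_zero_of_strictMono ω τ ε hI fun D => ?_
  obtain ⟨p, -, -, h⟩ := D.exists_eq_const ha
  have h01 : I ⟨0, by omega⟩ < I ⟨1, by omega⟩ := hI (Fin.mk_lt_mk.2 (by omega))
  have h12 : I ⟨1, by omega⟩ < I ⟨2, by omega⟩ := hI (Fin.mk_lt_mk.2 (by omega))
  exact not_mem_three_cycles ha hb h01 h12 (I ⟨2, by omega⟩).2 (h _) (h _) (h _)

/-- For `n = 0` the output would be a point generator of `Hom(L_i, L_i)`, which has none. For `n =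
1` a constant disc has equal input and output, hence equal degrees, whereas `m₁` raises degree by
one. For larger `n` no point lies on enough cycles. -/
theorem coeff_gen_eq_zero (ha : 0 < a) (hb : 0 < b) {n : ℕ} (hn : n ≠ 2)
    {I : Fin (n + 1) → Fin (a + b)} {e : Fin n → ℤ} {r : ℤ} (h : ∑ s, e s + 2 = r + n)
    (g : ∀ s : Fin n, Gen a b φ (I s.castSucc) (I s.succ) (e s))
    (q : Gen a b φ (I 0) (I (Fin.last n)) r) :
    coeff a b ω τ ε I (fun s => (g s).1) q.1 = 0 := by
  by_cases hI : StrictMono I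
  · rcases Nat.lt_or_ge n 2 with hn2 | hn2
    · refine coeff_eq_zero_of_strictMono ω τ ε hI fun D => ?_
      obtain ⟨p, hq, ho, -⟩ := D.exists_eq_const ha
      obtain ⟨q, hq1, hq2⟩ := q
      simp only at hq
      subst hq
      obtain rfl | rfl : n = 0 ∨ n = 1 := by omega
      · exact lt_irrefl _ hq1.1
      · have h0 := ho 0
        have hdeg := (g 0).2.2
        rw [h0] at hdeg
        have h1 : φ (I 1) p - φ (I 0) p = e 0 * Real.pi := hdeg
        have h2 : φ (I 1) p - φ (I 0) p = r * Real.pi := hq2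
        have h3 : (e 0 : ℝ) = r := mul_right_cancel₀ Real.pi_ne_zero (h1.symm.trans h2)
        have h4 : e 0 = r := by exact_mod_cast h3
        simp at h
        omega
    · exact coeff_eq_zero_of_two_le ω τ ε ha hb hn2 hI
  · rw [coeff, if_neg hI, if_neg fun h => hn h.1]

theorem lagVC_m_eq_zero (ha : 0 < a) (hb : 0 < b) {n : ℕ} (hn : n ≠ 2)
    (I : Fin (n + 1) → Fin (a + b)) (e : Fin n → ℤ) (r : ℤ) (h : ∑ s, e s + 2 = r + n) :
    (lagVC a b φ ω τ ε).m n I e r h = 0 := by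
  refine finsum_eq_zero_of_forall_eq_zero fun g => finsum_eq_zero_of_forall_eq_zero fun q => ?_
  rw [coeff_gen_eq_zero ω τ ε ha hb hn h, Finsupp.single_zero]
  ext f
  simp

/-- Ensures that the `finsum`s over generators defining `m` are genuine finite sums, not the default
value `0`. -/
theorem finite_gen (ha : 0 < a) (hb : 0 < b) (i j : Fin (a + b)) (n : ℤ) :
    Finite (Gen a b φ i j n) := by
  have h1 : (vanishingCycle a b i).Finite := by
    rw [vanishingCycle_eq ha hb]
    exact Set.toFinite _
  refine Set.Finite.to_subtype (((h1.image some).insert none).subset ?_)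
  rintro (_ | p) ⟨h, -⟩
  · exact Or.inl rfl
  · exact Or.inr ⟨p, h.2.1, rfl⟩

theorem lagVC_m_single (ha : 0 < a) (hb : 0 < b) {n : ℕ} (I : Fin (n + 1) → Fin (a + b))
    (e : Fin n → ℤ) (r : ℤ) (h : ∑ s, e s + 2 = r + n)
    (g : ∀ s : Fin n, Gen a b φ (I s.castSucc) (I s.succ) (e s)) :
    (lagVC a b φ ω τ ε).m n I e r h (fun s => Finsupp.single (g s) 1) =
      ∑ᶠ q : Gen a b φ (I 0) (I (Fin.last n)) r,
        Finsupp.single q (coeff a b ω τ ε I (fun s => (g s).1) q.1) := by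
  classical
  have := fun i j m => finite_gen (φ := φ) ha hb i j m
  have := Fintype.ofFinite (Gen a b φ (I 0) (I (Fin.last n)) r)
  have := Fintype.ofFinite (∀ s : Fin n, Gen a b φ (I s.castSucc) (I s.succ) (e s))
  simp only [finsum_eq_sum_of_fintype]
  rw [sum_apply, Finset.sum_eq_single g]
  · rw [sum_apply]
    refine Finset.sum_congr rfl fun q _ => ?_
    simp
  · intro g' _ hg'
    rw [sum_apply]
    refine Finset.sum_eq_zero fun q _ => ?_
    obtain ⟨s, hs⟩ := Function.ne_iff.1 hg'
    have : ∏ s, (Finsupp.single (g s) (1 : k)) (g' s) = 0 :=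
      Finset.prod_eq_zero (Finset.mem_univ s) (Finsupp.single_eq_of_ne hs)
    simp [this]
  · simp

theorem lagVC_comp_single (ha : 0 < a) (hb : 0 < b) {X Y Z : Fin (a + b)} {p q r : ℤ}
    (h : p + q = r) (f : Gen a b φ X Y p) (g : Gen a b φ Y Z q) :
    (lagVC a b φ ω τ ε).comp p q r h (Finsupp.single f (1 : k)) (Finsupp.single g (1 : k)) =
      ∑ᶠ c : Gen a b φ X Z r,
        Finsupp.single c (coeff a b ω τ ε ![X, Y, Z] ![f.1, g.1] c.1) := by
  have key := lagVC_m_single (k := k) (φ := φ) ω τ ε ha hb ![X, Y, Z] ![p, q] r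
    (by simp; omega) (Fin.cons f (Fin.cons g finZeroElim))
  have e1 : (fun s : Fin 2 => ((Fin.cons f (Fin.cons g finZeroElim) : ∀ s : Fin 2,
      Gen a b φ (![X, Y, Z] s.castSucc) (![X, Y, Z] s.succ) (![p, q] s)) s).1) = ![f.1, g.1] := by
    funext s
    fin_cases s <;> rfl
  rw [e1] at key
  refine Eq.trans ?_ key
  refine congrArg ((lagVC a b φ ω τ ε).m 2 ![X, Y, Z] ![p, q] r _) ?_
  funext s
  fin_cases s <;> rfl

/-! ### Units and associativity of `m₂`. -/

theorem finsum_single_ite {X Y : Fin (a + b)} {p : ℤ}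
    (f : Gen a b φ X Y p) (c : Option (ℂ × ℂ) → k) (h1 : c f.1 = 1)
    (h0 : ∀ o, o ≠ f.1 → c o = 0) :
    ∑ᶠ q : Gen a b φ X Y p, Finsupp.single q (c q.1) = Finsupp.single f 1 := by
  rw [finsum_eq_single _ f, h1]
  intro q hq
  rw [h0 _ fun h => hq (Subtype.ext h), Finsupp.single_zero]

theorem not_strictMono_left (X Y : Fin (a + b)) : ¬StrictMono ![X, X, Y] := fun h =>
  lt_irrefl X (h (show (0 : Fin 3) < 1 by decide))

theorem not_strictMono_right (X Y : Fin (a + b)) : ¬StrictMono ![X, Y, Y] := fun h =>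
  lt_irrefl Y (h (show (1 : Fin 3) < 2 by decide))

theorem coeff_none_left (X Y : Fin (a + b)) (o q : Option (ℂ × ℂ)) [Decidable (q = o)] :
    coeff a b ω τ ε ![X, X, Y] ![none, o] q = if q = o then 1 else 0 := by
  rw [coeff, if_neg (not_strictMono_left X Y)]
  refine if_congr ?_ rfl rfl
  constructor
  · rintro ⟨-, s, s', hs, h1, h2⟩
    fin_cases s <;> fin_cases s' <;> simp_all
  · rintro rfl
    exact ⟨rfl, 0, 1, by decide, rfl, rfl⟩

theorem coeff_none_right (X Y : Fin (a + b)) (o q : Option (ℂ × ℂ)) [Decidable (q = o)] :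
    coeff a b ω τ ε ![X, Y, Y] ![o, none] q = if q = o then 1 else 0 := by
  rw [coeff, if_neg (not_strictMono_right X Y)]
  refine if_congr ?_ rfl rfl
  constructor
  · rintro ⟨-, s, s', hs, h1, h2⟩
    fin_cases s <;> fin_cases s' <;> simp_all
  · rintro rfl
    exact ⟨rfl, 1, 0, by decide, rfl, rfl⟩

theorem coeff_some_some (ha : 0 < a) (hb : 0 < b) (X Y Z : Fin (a + b)) (x y : ℂ × ℂ)
    (q : Option (ℂ × ℂ)) : coeff a b ω τ ε ![X, Y, Z] ![some x, some y] q = 0 := by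
  by_cases hI : StrictMono ![X, Y, Z]
  · exact coeff_eq_zero_of_two_le ω τ ε ha hb le_rfl hI
  · rw [coeff, if_neg hI, if_neg]
    rintro ⟨-, s, s', -, h, -⟩
    fin_cases s <;> simp at h

theorem lagVC_one_comp (ha : 0 < a) (hb : 0 < b) {X Y : Fin (a + b)} (p : ℤ) (h : 0 + p = p)
    (f : Gen a b φ X Y p →₀ k) :
    (lagVC a b φ ω τ ε).comp 0 p p h ((lagVC a b φ ω τ ε).one X) f = f := by
  classical
  suffices hl : (lagVC a b φ ω τ ε).comp (X := X) (Y := X) (Z := Y) 0 p p h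
      ((lagVC a b φ ω τ ε).one X) = LinearMap.id from LinearMap.congr_fun hl f
  refine Finsupp.lhom_ext' fun g => LinearMap.ext_ring ?_
  refine (lagVC_comp_single ω τ ε ha hb h _ g).trans ?_
  refine finsum_single_ite g (fun o => coeff a b ω τ ε ![X, X, Y] ![none, g.1] o) ?_ ?_
  · simp [coeff_none_left]
  · intro o ho
    simp [coeff_none_left, ho]

theorem lagVC_comp_one (ha : 0 < a) (hb : 0 < b) {X Y : Fin (a + b)} (p : ℤ) (h : p + 0 = p)
    (f : Gen a b φ X Y p →₀ k) :
    (lagVC a b φ ω τ ε).comp p 0 p h f ((lagVC a b φ ω τ ε).one Y) = f := by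
  classical
  suffices hl : ((lagVC a b φ ω τ ε).comp (X := X) (Y := Y) (Z := Y) p 0 p h).flip
      ((lagVC a b φ ω τ ε).one Y) = LinearMap.id from LinearMap.congr_fun hl f
  refine Finsupp.lhom_ext' fun g => LinearMap.ext_ring ?_
  refine (lagVC_comp_single ω τ ε ha hb h g _).trans ?_
  refine finsum_single_ite g (fun o => coeff a b ω τ ε ![X, Y, Y] ![g.1, none] o) ?_ ?_
  · simp [coeff_none_right]
  · intro o ho
    simp [coeff_none_right, ho]

theorem lagVC_comp_some (ha : 0 < a) (hb : 0 < b) {X Y Z : Fin (a + b)} {p q r : ℤ}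
    (h : p + q = r) (f : Gen a b φ X Y p) (g : Gen a b φ Y Z q) (hf : f.1 ≠ none)
    (hg : g.1 ≠ none) :
    (lagVC a b φ ω τ ε).comp p q r h (Finsupp.single f (1 : k)) (Finsupp.single g (1 : k)) = 0 := by
  rw [lagVC_comp_single ω τ ε ha hb]
  obtain ⟨x, hx⟩ := Option.ne_none_iff_exists'.1 hf
  obtain ⟨y, hy⟩ := Option.ne_none_iff_exists'.1 hg
  refine finsum_eq_zero_of_forall_eq_zero fun q => ?_
  rw [hx, hy, coeff_some_some ω τ ε ha hb, Finsupp.single_zero]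

/-- If one factor is an identity, the unit laws suffice. Otherwise both inner products already
vanish. -/
theorem lagVC_assoc_single (ha : 0 < a) (hb : 0 < b) {X Y Z T : Fin (a + b)}
    {p q r pq qr s : ℤ} (h₁ : p + q = pq) (h₂ : q + r = qr) (h₃ : pq + r = s) (h₄ : p + qr = s)
    (f : Gen a b φ X Y p) (g : Gen a b φ Y Z q) (h : Gen a b φ Z T r) :
    (lagVC a b φ ω τ ε).comp pq r s h₃ ((lagVC a b φ ω τ ε).comp p q pq h₁
        (Finsupp.single f (1 : k)) (Finsupp.single g (1 : k))) (Finsupp.single h (1 : k)) =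
      (lagVC a b φ ω τ ε).comp p qr s h₄ (Finsupp.single f (1 : k))
        ((lagVC a b φ ω τ ε).comp q r qr h₂ (Finsupp.single g (1 : k))
          (Finsupp.single h (1 : k))) := by
  by_cases hf : f.1 = none
  · obtain ⟨_, f1, f2⟩ := f
    -- A generator `none` forces equal objects and degree zero, so it is the unit itself.
    subst hf f1 f2
    obtain rfl : q = pq := by omega
    obtain rfl : qr = s := by omega
    have e1 := lagVC_one_comp (φ := φ) ω τ ε ha hb q h₁ (Finsupp.single g (1 : k))
    have e2 := lagVC_one_comp (φ := φ) ω τ ε ha hb qr h₄ ((lagVC a b φ ω τ ε).comp q r qr h₂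
      (Finsupp.single g (1 : k)) (Finsupp.single h (1 : k)))
    exact (congrArg (fun x => (lagVC a b φ ω τ ε).comp q r qr h₃ x
      (Finsupp.single h (1 : k))) e1).trans e2.symm
  by_cases hg : g.1 = none
  · obtain ⟨_, g1, g2⟩ := g
    subst hg g1 g2
    obtain rfl : p = pq := by omega
    obtain rfl : r = qr := by omega
    have e1 := lagVC_comp_one (φ := φ) ω τ ε ha hb p h₁ (Finsupp.single f (1 : k))
    have e2 := lagVC_one_comp (φ := φ) ω τ ε ha hb r h₂ (Finsupp.single h (1 : k))
    exact (congrArg (fun x => (lagVC a b φ ω τ ε).comp p r s h₃ x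
      (Finsupp.single h (1 : k))) e1).trans (congrArg (fun x =>
        (lagVC a b φ ω τ ε).comp p r s h₄ (Finsupp.single f (1 : k)) x) e2).symm
  by_cases hh : h.1 = none
  · obtain ⟨_, j1, j2⟩ := h
    subst hh j1 j2
    obtain rfl : pq = s := by omega
    obtain rfl : q = qr := by omega
    have e1 := lagVC_comp_one (φ := φ) ω τ ε ha hb pq h₃ ((lagVC a b φ ω τ ε).comp p q pq h₁
      (Finsupp.single f (1 : k)) (Finsupp.single g (1 : k)))
    have e2 := lagVC_comp_one (φ := φ) ω τ ε ha hb q h₂ (Finsupp.single g (1 : k))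
    exact e1.trans (congrArg (fun x =>
        (lagVC a b φ ω τ ε).comp p q pq h₄ (Finsupp.single f (1 : k)) x) e2).symm
  rw [lagVC_comp_some ω τ ε ha hb h₁ f g hf hg, lagVC_comp_some ω τ ε ha hb h₂ g h hg hh,
    map_zero, LinearMap.zero_apply, map_zero]

theorem lagVC_assoc (ha : 0 < a) (hb : 0 < b) {X Y Z T : Fin (a + b)}
    {p q r pq qr s : ℤ} (h₁ : p + q = pq) (h₂ : q + r = qr) (h₃ : pq + r = s) (h₄ : p + qr = s)
    (f : Gen a b φ X Y p →₀ k) (g : Gen a b φ Y Z q →₀ k) (h : Gen a b φ Z T r →₀ k) :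
    (lagVC a b φ ω τ ε).comp pq r s h₃ ((lagVC a b φ ω τ ε).comp p q pq h₁ f g) h =
      (lagVC a b φ ω τ ε).comp p qr s h₄ f ((lagVC a b φ ω τ ε).comp q r qr h₂ g h) := by
  have hl : ((lagVC a b φ ω τ ε).comp (X := X) (Y := Y) (Z := Z) p q pq h₁).compr₂
      ((lagVC a b φ ω τ ε).comp (X := X) (Y := Z) (Z := T) pq r s h₃) =
      ((LinearMap.llcomp k _ _ _).flip.comp
        ((lagVC a b φ ω τ ε).comp (X := Y) (Y := Z) (Z := T) q r qr h₂)).flip.comp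
        ((lagVC a b φ ω τ ε).comp (X := X) (Y := Y) (Z := T) p qr s h₄) := by
    refine Finsupp.lhom_ext' fun f => LinearMap.ext_ring ?_
    refine Finsupp.lhom_ext' fun g => LinearMap.ext_ring ?_
    refine Finsupp.lhom_ext' fun h => LinearMap.ext_ring ?_
    exact lagVC_assoc_single ω τ ε ha hb h₁ h₂ h₃ h₄ f g h
  exact LinearMap.congr_fun (LinearMap.congr_fun (LinearMap.congr_fun hl f) g) h

theorem lagVC_d (ha : 0 < a) (hb : 0 < b) {X Y : Fin (a + b)} (p q : ℤ) (h : p + 1 = q) :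
    (lagVC a b φ ω τ ε).d (X := X) (Y := Y) p q h = 0 := by
  refine LinearMap.ext fun f => ?_
  have h1 : ∑ s : Fin 1, ![p] s + 2 = q + (1 : ℕ) := by simp; omega
  exact congrArg (fun m : MultilinearMap k
    (fun s : Fin 1 => (lagVC a b φ ω τ ε).Hom (![X, Y] s.castSucc) (![X, Y] s.succ) (![p] s)) _ =>
      m (Fin.cons f finZeroElim))
    (lagVC_m_eq_zero (φ := φ) ω τ ε ha hb (n := 1) (by decide) ![X, Y] ![p] q h1)

/-- `Lag_vc` is a DG category with zero differential, whatever the gradings, areas and signs. -/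
theorem lagVC_isDG (ha : 0 < a) (hb : 0 < b) : (lagVC a b φ ω τ ε).IsDG where
  m_eq_zero n _ h2 I e r h := lagVC_m_eq_zero ω τ ε ha hb h2 I e r h
  d_d p q r h h' f := by
    rw [lagVC_d ω τ ε ha hb, LinearMap.zero_apply]
  leibniz p q r h f g := by
    rw [lagVC_d ω τ ε ha hb, lagVC_d ω τ ε ha hb, lagVC_d ω τ ε ha hb, LinearMap.zero_apply,
      LinearMap.zero_apply, LinearMap.zero_apply, map_zero, map_zero, LinearMap.zero_apply,
      smul_zero, add_zero]
  one_comp p f := lagVC_one_comp ω τ ε ha hb p _ f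
  comp_one p f := lagVC_comp_one ω τ ε ha hb p _ f
  assoc p q r pq qr s h₁ h₂ h₃ h₄ f g h := lagVC_assoc ω τ ε ha hb h₁ h₂ h₃ h₄ f g h

end

end MirrorLine

/-! ### Bases of the pieces of `Λ_θ` -/

section

variable {k : Type*} [Field k] (θ : Matrix (Fin 2) (Fin 2) kˣ)

/-- The quotient of `Λ_θ` by all products of two generators. -/
def lambdaToTrivSqZeroExt : LambdaAlg θ →ₐ[k] TrivSqZeroExt k (Fin 2 → k) :=
  RingQuot.liftAlgHom k ⟨FreeAlgebra.lift k fun i => TrivSqZeroExt.inr (Pi.single i 1), by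
    rintro _ _ (⟨i, j⟩ | ⟨i⟩) <;> simp⟩

theorem lambdaToTrivSqZeroExt_gen (i : Fin 2) :
    lambdaToTrivSqZeroExt θ (lambdaGen θ i) = TrivSqZeroExt.inr (Pi.single i 1) := by
  rw [lambdaToTrivSqZeroExt, lambdaGen, RingQuot.liftAlgHom_mkAlgHom_apply, FreeAlgebra.lift_ι_apply]

theorem lambdaGen_mul_self (i : Fin 2) : lambdaGen θ i * lambdaGen θ i = 0 := by
  rw [lambdaGen, ← map_mul, RingQuot.mkAlgHom_rel k (LambdaRel.sq i), map_zero]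

/-- All relations are quadratic, so they die in the square-zero extension of `k` by `k²`, where the
images of `1, y₀, y₁` are visibly independent. -/
theorem linearIndependent_lambda :
    LinearIndependent k ![(1 : LambdaAlg θ), lambdaGen θ 0, lambdaGen θ 1] := by
  apply LinearIndependent.of_comp (lambdaToTrivSqZeroExt θ).toLinearMap
  rw [Fintype.linearIndependent_iff]
  intro g hg
  simp only [Fin.sum_univ_three, Function.comp_apply, AlgHom.toLinearMap_apply, Matrix.cons_val,
    map_one, lambdaToTrivSqZeroExt_gen] at hg
  have h1 := congrArg TrivSqZeroExt.fst hg
  have h2 := congrFun (congrArg TrivSqZeroExt.snd hg) 0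
  have h3 := congrFun (congrArg TrivSqZeroExt.snd hg) 1
  simp at h1 h2 h3
  intro i
  fin_cases i
  · exact h1
  · exact h2
  · exact h3

theorem wordWeight_cons (a b : ℕ) (x : Fin 2) (w : List (Fin 2)) :
    wordWeight a b (x :: w) = ![-(a : ℤ), -(b : ℤ)] x + wordWeight a b w := by
  simp [wordWeight]

theorem wordWeight_nonpos (a b : ℕ) (w : List (Fin 2)) : wordWeight a b w ≤ 0 := by
  induction w with
  | nil => simp [wordWeight]
  | cons x w ih =>
    rw [wordWeight_cons]
    fin_cases x <;> simp <;> omega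

/-- Words of length at least two vanish in `Λ_θ` if their internal degree is greater than that
of `y₀ y₁`. -/
theorem prod_lambdaGen_eq_zero {a b : ℕ} {w : List (Fin 2)} (hw : 2 ≤ w.length)
    (hlt : -((a : ℤ) + b) < wordWeight a b w) : (w.map (lambdaGen θ)).prod = 0 := by
  obtain _ | ⟨x, _ | ⟨y, w⟩⟩ := w
  · simp at hw
  · simp at hw
  · have h := wordWeight_nonpos a b w
    rw [wordWeight_cons, wordWeight_cons] at hlt
    -- Two distinct first letters already have total degree `-(a+b)`, and the remaining letters can
    -- only lower it.
    have hxy : x = y := by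
      fin_cases x <;> fin_cases y <;> simp at hlt ⊢ <;> omega
    rw [hxy, List.map_cons, List.map_cons, List.prod_cons, List.prod_cons, ← mul_assoc,
      lambdaGen_mul_self, zero_mul]

theorem lambdaPiece_eq_bot {a b : ℕ} {p i : ℤ} (hp : 2 ≤ p) (hi : -((a : ℤ) + b) < i) :
    lambdaPiece a b θ p i = ⊥ := by
  rw [eq_bot_iff, lambdaPiece, Submodule.span_le]
  rintro _ ⟨w, h1, rfl, rfl⟩
  exact prod_lambdaGen_eq_zero θ (by omega) hi

end

namespace MirrorLine

open Set

/-! ### The equivalence -/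

section

variable {a b : ℕ}

/-- The index in `1, y₀, y₁` of a generator of `Hom(L_i, L_j)`. -/
def genIndex (a b : ℕ) (i : Fin (a + b)) : Option (ℂ × ℂ) → Fin 3
  | none => 0
  | some p => open Classical in if p = fiberPoint a b (-2 * (i : ℕ) + b) then 1 else 2

theorem gen_some_cases (ha : 0 < a) (hb : 0 < b) {i j : Fin (a + b)} {p : ℂ × ℂ}
    (h : IsGen a b i j (some p)) :
    ((i : ℕ) + a = j ∧ p = fiberPoint a b (-2 * (i : ℕ) + b) ∧ genIndex a b i (some p) = 1) ∨
      ((i : ℕ) + b = j ∧ p = fiberPoint a b (-2 * (i : ℕ) - b) ∧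
        genIndex a b i (some p) = 2) := by
  rcases (mem_inter_iff ha hb h.1 j.2 p).1 ⟨h.2.1, h.2.2⟩ with ⟨e, rfl⟩ | ⟨e, rfl⟩
  · exact Or.inl ⟨e, rfl, if_pos rfl⟩
  · exact Or.inr ⟨e, rfl, if_neg (fiberPoint_neg_ne ha hb _)⟩

/-- The gradings for which all intersection points have degree one. -/
abbrev gradings (a b : ℕ) (j : Fin (a + b)) : ℂ × ℂ → ℝ := cycleGrading a b j

theorem hasDegree_one (ha : 0 < a) (hb : 0 < b) {i j : Fin (a + b)} {p : ℂ × ℂ}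
    (h : IsGen a b i j (some p)) : HasDegree a b (gradings a b) i j (some p) 1 := by
  rw [HasDegree, Int.cast_one, one_mul]
  exact cycleGrading_sub ha hb h.1 j.2 h.2.1 h.2.2

theorem hasDegree_some (ha : 0 < a) (hb : 0 < b) {i j : Fin (a + b)} {p : ℂ × ℂ} {n : ℤ}
    (h : IsGen a b i j (some p)) (hn : HasDegree a b (gradings a b) i j (some p) n) : n = 1 := by
  have h1 := (hasDegree_one ha hb h).symm.trans hn
  have h2 := mul_right_cancel₀ Real.pi_ne_zero h1
  exact_mod_cast h2.symm

/-- Also covers `a = b`, when both ends of `L_i` can lie on the same `L_j`: the index records the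
end, not the target. -/
theorem genIndex_injective (ha : 0 < a) (hb : 0 < b) {i j : Fin (a + b)} {n : ℤ} :
    Function.Injective fun g : Gen a b (gradings a b) i j n => genIndex a b i g.1 := by
  rintro ⟨_ | p, hp, hp'⟩ ⟨_ | q, hq, hq'⟩ h
  · rfl
  · exact absurd hp hq.1.ne
  · exact absurd hq hp.1.ne
  · simp only at h
    rcases gen_some_cases ha hb hp with ⟨-, e1, e⟩ | ⟨-, e1, e⟩ <;>
      rcases gen_some_cases ha hb hq with ⟨-, e2, e'⟩ | ⟨-, e2, e'⟩ <;>
      rw [e, e'] at h <;> first | (subst e1 e2; rfl) | (exact absurd h (by decide))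

variable {k : Type*} [Field k] (θ : Matrix (Fin 2) (Fin 2) kˣ)

/-- The element `1`, `y₀` or `y₁` of `Λ_θ` corresponding to a generator. -/
def genValue (i : Fin (a + b)) (o : Option (ℂ × ℂ)) : LambdaAlg θ :=
  ![(1 : LambdaAlg θ), lambdaGen θ 0, lambdaGen θ 1] (genIndex a b i o)

theorem rev_sub_rev (i j : Fin (a + b)) : ((j.rev : ℕ) : ℤ) - ((i.rev : ℕ) : ℤ) = (i : ℕ) - (j : ℕ) := by
  rw [Fin.val_rev, Fin.val_rev]
  omega

theorem genValue_mem (ha : 0 < a) (hb : 0 < b) {i j : Fin (a + b)} {n : ℤ}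
    (g : Gen a b (gradings a b) i j n) :
    genValue θ i g.1 ∈ lambdaPiece a b θ n (((j.rev : ℕ) : ℤ) - ((i.rev : ℕ) : ℤ)) := by
  rw [rev_sub_rev]
  obtain ⟨_ | p, hp, hp'⟩ := g
  · obtain rfl : i = j := hp
    obtain rfl : n = 0 := hp'
    exact one_mem_lambdaPiece a b θ (sub_self _).symm
  · obtain rfl := hasDegree_some ha hb hp hp'
    rcases gen_some_cases ha hb hp with ⟨e, -, h⟩ | ⟨e, -, h⟩
    · refine Submodule.subset_span ⟨[0], rfl, ?_, ?_⟩
      · simp [wordWeight]; omega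
      · simp [genValue, h]
    · refine Submodule.subset_span ⟨[1], rfl, ?_, ?_⟩
      · simp [wordWeight]; omega
      · simp [genValue, h]

/-- The map on morphism spaces from `Lag_vc` to `𝔆_θ`. -/
def homMap (ha : 0 < a) (hb : 0 < b) (i j : Fin (a + b)) (n : ℤ) :
    (Gen a b (gradings a b) i j n →₀ k) →ₗ[k]
      lambdaPiece a b θ n (((j.rev : ℕ) : ℤ) - ((i.rev : ℕ) : ℤ)) :=
  Finsupp.linearCombination k fun g => ⟨genValue θ i g.1, genValue_mem θ ha hb g⟩

theorem homMap_single (ha : 0 < a) (hb : 0 < b) {i j : Fin (a + b)} {n : ℤ}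
    (g : Gen a b (gradings a b) i j n) :
    homMap θ ha hb i j n (Finsupp.single g 1) = ⟨genValue θ i g.1, genValue_mem θ ha hb g⟩ := by
  rw [homMap, Finsupp.linearCombination_single, one_smul]

theorem homMap_injective (ha : 0 < a) (hb : 0 < b) (i j : Fin (a + b)) (n : ℤ) :
    Function.Injective (homMap θ ha hb i j n) := by
  have h : LinearIndependent k fun g : Gen a b (gradings a b) i j n => genValue θ i g.1 :=
    (linearIndependent_lambda θ).comp _ (genIndex_injective ha hb)
  exact LinearIndependent.of_comp (Submodule.subtype _) h

/-- The piece is spanned by words of internal degree `i - j`. The empty word and the two letters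
come from generators of `Lag_vc`, and longer words vanish since `i - j > -(a+b)`. -/
theorem homMap_surjective (ha : 0 < a) (hb : 0 < b) (i j : Fin (a + b)) (n : ℤ) :
    Function.Surjective (homMap θ ha hb i j n) := by
  have hle : lambdaPiece a b θ n (((j.rev : ℕ) : ℤ) - ((i.rev : ℕ) : ℤ)) ≤
      (LinearMap.range (homMap θ ha hb i j n)).map (Submodule.subtype _) := by
    conv_lhs => rw [lambdaPiece]
    rw [Submodule.span_le]
    have key : ∀ g : Gen a b (gradings a b) i j n, genValue θ i g.1 ∈
        (LinearMap.range (homMap θ ha hb i j n)).map (Submodule.subtype _) := fun g =>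
      ⟨_, ⟨Finsupp.single g 1, rfl⟩, by rw [homMap_single]; rfl⟩
    rintro _ ⟨w, hlen, hwt, rfl⟩
    rw [rev_sub_rev] at hwt
    rcases w with _ | ⟨x, _ | ⟨y, w⟩⟩
    · obtain rfl : i = j := by
        simp [wordWeight] at hwt
        omega
      exact key ⟨none, rfl, show n = 0 by simpa using hlen.symm⟩
    · obtain rfl : n = 1 := by simpa using hlen.symm
      rw [wordWeight_cons] at hwt
      fin_cases x <;> simp [wordWeight] at hwt
      · have hj : (i : ℕ) + a = j := by omega
        have hg : IsGen a b i j (some (fiberPoint a b (-2 * (i : ℕ) + b))) :=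
          ⟨Fin.lt_def.2 (by omega),
            (mem_inter_iff ha hb (by omega) j.2 _).2 (Or.inl ⟨hj, rfl⟩)⟩
        have := key ⟨_, hg, hasDegree_one ha hb hg⟩
        simpa [genValue, genIndex] using this
      · have hj : (i : ℕ) + b = j := by omega
        have hg : IsGen a b i j (some (fiberPoint a b (-2 * (i : ℕ) - b))) :=
          ⟨Fin.lt_def.2 (by omega),
            (mem_inter_iff ha hb (by omega) j.2 _).2 (Or.inr ⟨hj, rfl⟩)⟩
        have := key ⟨_, hg, hasDegree_one ha hb hg⟩
        have hv : genValue θ i (some (fiberPoint a b (-2 * (i : ℕ) - b))) = lambdaGen θ 1 := by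
          rw [genValue, genIndex, if_neg (fiberPoint_neg_ne ha hb _)]
          rfl
        rw [hv] at this
        simpa using this
    · rw [prod_lambdaGen_eq_zero (a := a) (b := b) θ (by simp) (by rw [hwt]; omega)]
      exact zero_mem _
  intro x
  obtain ⟨_, ⟨f, rfl⟩, hf⟩ := hle x.2
  exact ⟨f, Subtype.ext hf⟩

variable (ω : ℂ × ℂ → (ℂ × ℂ) [⋀^Fin 2]→L[ℝ] ℝ) (τ : Multiplicative ℝ →* kˣ) (ε : Signs a b)

theorem homMap_one (ha : 0 < a) (hb : 0 < b) (i : Fin (a + b)) :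
    homMap θ ha hb i i 0 ((lagVC a b (gradings a b) ω τ ε).one i) =
      (frakC a b θ).one i.rev :=
  homMap_single θ ha hb _

theorem homMap_comp_single (ha : 0 < a) (hb : 0 < b) {X Y Z : Fin (a + b)} {p q r : ℤ}
    (h : p + q = r) (f : Gen a b (gradings a b) X Y p) (g : Gen a b (gradings a b) Y Z q) :
    homMap θ ha hb X Z r ((lagVC a b (gradings a b) ω τ ε).comp p q r h
        (Finsupp.single f (1 : k)) (Finsupp.single g (1 : k))) =
      (frakC a b θ).comp (X := X.rev) (Y := Y.rev) (Z := Z.rev) p q r h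
        (homMap θ ha hb X Y p (Finsupp.single f 1)) (homMap θ ha hb Y Z q (Finsupp.single g 1)) := by
  by_cases hf : f.1 = none
  · obtain ⟨_, f1, f2⟩ := f
    subst hf f1 f2
    obtain rfl : q = r := by omega
    refine (congrArg _ (lagVC_one_comp (φ := gradings a b) ω τ ε ha hb q h _)).trans ?_
    refine ((frakC a b θ).one_comp q _).symm.trans ?_
    rw [← homMap_one θ ω τ ε ha hb]
  by_cases hg : g.1 = none
  · obtain ⟨_, g1, g2⟩ := g
    subst hg g1 g2
    obtain rfl : p = r := by omega
    refine (congrArg _ (lagVC_comp_one (φ := gradings a b) ω τ ε ha hb p h _)).trans ?_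
    refine ((frakC a b θ).comp_one p _).symm.trans ?_
    rw [← homMap_one θ ω τ ε ha hb]
  rw [lagVC_comp_some ω τ ε ha hb h f g hf hg, map_zero]
  obtain ⟨x, hx⟩ := Option.ne_none_iff_exists'.1 hf
  obtain ⟨y, hy⟩ := Option.ne_none_iff_exists'.1 hg
  obtain rfl : p = 1 := hasDegree_some ha hb (hx ▸ f.2.1) (hx ▸ f.2.2)
  obtain rfl : q = 1 := hasDegree_some ha hb (hy ▸ g.2.1) (hy ▸ g.2.2)
  -- Two point generators have degree one each, so the product has degree `r = 2`, in an internal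
  -- degree above `-(a+b)`. The target is zero, matching the vanishing product in `Lag_vc`.
  have hbot : lambdaPiece a b θ r (((Z.rev : ℕ) : ℤ) - ((X.rev : ℕ) : ℤ)) = ⊥ :=
    lambdaPiece_eq_bot θ (by omega) (by omega)
  have hsub : ∀ z : lambdaPiece a b θ r (((Z.rev : ℕ) : ℤ) - ((X.rev : ℕ) : ℤ)), 0 = z :=
    fun z => Subtype.ext (((Submodule.mem_bot k).1 (hbot ▸ z.2)).symm)
  exact hsub _

/-- The DG functor from `Lag_vc` to `𝔆_θ`, which reverses the order of the objects. -/
def mirrorFunctor (ha : 0 < a) (hb : 0 < b) :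
    DGFunctor ((lagVC a b (gradings a b) ω τ ε).toDGCat (lagVC_isDG ω τ ε ha hb))
      (frakC a b θ) where
  obj := Fin.rev
  map {X Y} n := homMap θ ha hb X Y n
  map_d {X Y} p q h f := by
    refine (congrArg (homMap θ ha hb X Y q) (LinearMap.congr_fun
      (lagVC_d (φ := gradings a b) ω τ ε ha hb (X := X) (Y := Y) p q h) f)).trans ?_
    exact map_zero (homMap θ ha hb X Y q)
  map_comp {X Y Z} p q r h f g := by
    have hl : ((lagVC a b (gradings a b) ω τ ε).comp (X := X) (Y := Y) (Z := Z) p q r h).compr₂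
        (homMap θ ha hb X Z r) =
        ((frakC a b θ).comp (X := X.rev) (Y := Y.rev) (Z := Z.rev) p q r h).compl₁₂
          (homMap θ ha hb X Y p) (homMap θ ha hb Y Z q) := by
      refine Finsupp.lhom_ext' fun f => LinearMap.ext_ring ?_
      refine Finsupp.lhom_ext' fun g => LinearMap.ext_ring ?_
      exact homMap_comp_single θ ω τ ε ha hb h f g
    exact LinearMap.congr_fun (LinearMap.congr_fun hl f) g
  map_one X := homMap_one θ ω τ ε ha hb X

theorem mirrorFunctor_isEquivalence (ha : 0 < a) (hb : 0 < b) :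
    (mirrorFunctor θ ω τ ε ha hb).IsEquivalence := by
  refine ⟨fun X Y n => ⟨homMap_injective θ ha hb X Y n, homMap_surjective θ ha hb X Y n⟩,
    fun Z => ?_⟩
  obtain ⟨X, rfl⟩ : ∃ X : Fin (a + b), X.rev = Z := ⟨Fin.rev Z, Fin.rev_rev Z⟩
  exact ⟨X, (frakC a b θ).one X.rev, (frakC a b θ).one X.rev, rfl, rfl,
    (frakC a b θ).one_comp 0 _, (frakC a b θ).one_comp 0 _⟩

end

end MirrorLine

end

/-! ### Assembly of the theorem. -/

theorem theorem3p3 {k : Type*} [Field k] (a b : ℕ) (ha : 0 < a) (hb : 0 < b)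
    (hab : Nat.Coprime a b) :
    ∃ φ : Fin (a + b) → ℂ × ℂ → ℝ,
      (∀ j : Fin (a + b), MirrorLine.IsGrading a b j (φ j)) ∧
      (∃ (x : Fin b → ℂ × ℂ) (y : Fin a → ℂ × ℂ),
        Function.Injective (Sum.elim x y) ∧
        (∀ i j : Fin (a + b), i < j →
          MirrorLine.vanishingCycle a b i ∩ MirrorLine.vanishingCycle a b j =
            {p | (∃ s : Fin b, (s : ℕ) = i ∧ (s : ℕ) + a = j ∧ p = x s) ∨
              ∃ s : Fin a, (s : ℕ) = i ∧ (s : ℕ) + b = j ∧ p = y s}) ∧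
        (∀ (s : Fin b) (i j : Fin (a + b)), (s : ℕ) = i → (s : ℕ) + a = j →
          MirrorLine.HasDegree a b φ i j (some (x s)) 1) ∧
        ∀ (s : Fin a) (i j : Fin (a + b)), (s : ℕ) = i → (s : ℕ) + b = j →
          MirrorLine.HasDegree a b φ i j (some (y s)) 1) ∧
      ∀ (ω : ℂ × ℂ → (ℂ × ℂ) [⋀^Fin 2]→L[ℝ] ℝ) (τ : Multiplicative ℝ →* kˣ)
        (ε : MirrorLine.Signs a b),
        ∃ h : (MirrorLine.lagVC a b φ ω τ ε).IsDG,
          ∀ θ : Matrix (Fin 2) (Fin 2) kˣ,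
            ∃ F : DGFunctor ((MirrorLine.lagVC a b φ ω τ ε).toDGCat h) (frakC a b θ),
              F.IsEquivalence ∧
              ∀ j : Fin (a + b), F.obj j = (Fin.rev j : Fin (a + b)) := by
  refine ⟨MirrorLine.gradings a b, fun j => MirrorLine.isGrading_cycleGrading ha hb j,
    ⟨fun s => MirrorLine.fiberPoint a b (-2 * (s : ℕ) + b),
      fun s => MirrorLine.fiberPoint a b (-2 * (s : ℕ) - b),
      MirrorLine.injective_intersections ha hb, ?_, ?_, ?_⟩, ?_⟩
  · intro i j hij
    ext p
    refine (MirrorLine.mem_inter_iff ha hb hij j.2 p).trans (or_congr ?_ ?_)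
    · constructor
      · rintro ⟨h, rfl⟩
        exact ⟨⟨i, by omega⟩, rfl, h, rfl⟩
      · rintro ⟨s, h1, h2, rfl⟩
        exact ⟨h1 ▸ h2, by dsimp only; rw [h1]⟩
    · constructor
      · rintro ⟨h, rfl⟩
        exact ⟨⟨i, by omega⟩, rfl, h, rfl⟩
      · rintro ⟨s, h1, h2, rfl⟩
        exact ⟨h1 ▸ h2, by dsimp only; rw [h1]⟩
  · intro s i j h1 h2
    have hij : i < j := Fin.lt_def.2 (by omega)
    have h := (MirrorLine.mem_inter_iff ha hb hij j.2 _).2 (Or.inl ⟨h1 ▸ h2, rfl⟩)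
    dsimp only
    rw [h1]
    exact MirrorLine.hasDegree_one ha hb ⟨hij, h⟩
  · intro s i j h1 h2
    have hij : i < j := Fin.lt_def.2 (by omega)
    have h := (MirrorLine.mem_inter_iff ha hb hij j.2 _).2 (Or.inr ⟨h1 ▸ h2, rfl⟩)
    dsimp only
    rw [h1]
    exact MirrorLine.hasDegree_one ha hb ⟨hij, h⟩
  · intro ω τ ε
    exact ⟨MirrorLine.lagVC_isDG ω τ ε ha hb, fun θ => ⟨MirrorLine.mirrorFunctor θ ω τ ε ha hb,
      MirrorLine.mirrorFunctor_isEquivalence θ ω τ ε ha hb, fun j => rfl⟩⟩
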